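/- Let $k$ be a field with $\operatorname{char}(k)\neq 2$, let $V$ be a $k$-vector space with basis $x_1,\dots,x_n$, and let $\mu=(\mu_{ij})\in M(n,k)$ be multiplicatively antisymmetric, i.e. $\mu_{ij}\mu_{ji}=\mu_{ii}=1$ for all $i,j$. A bilinear form $\varphi$ on $V$ is $\mu$-symmetric if $\varphi(x_i,x_j)=\mu_{ij}\varphi(x_j,x_i)$ for all $i,j$; in that case the skew Clifford algebra $\mathrm{sCl}(V,\mu,\varphi)$ is the quotient of the tensor algebra $T(V)$ by the two-sided ideal generated by the elements $x_i\otimes x_j+\mu_{ij}\,x_j\otimes x_i-2\varphi(x_i,x_j)\cdot 1$ for all $i,j$, and it is called nontrivial if it is not the zero algebra. The quantum exterior algebra is $\Lambda_\mu(V)=\mathrm{sCl}(V,\mu,0)$. Let $F^iT=\bigoplus_{j\le i}T^j(V)$, and let $\pi:F^2T\to V\otimes V$ be the projection. A PBW deformation of $\Lambda_\mu(V)$ is an algebra $R=T(V)/\langle P\rangle$, where $P\subset F^2T$ is a subspace such that $\pi(P)$ is the span of the elements $x_i\otimes x_j+\mu_{ij}\,x_j\otimes x_i$, for which the natural projection $\Lambda_\mu(V)\to\mathrm{gr}(R)$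 is an isomorphism; here $\mathrm{gr}(R)$ is the associated graded algebra of $R$ for the filtration induced by $F^iT$. The deformation is called $\mathbb{Z}_2$-graded if $R$ has a $\mathbb{Z}_2$-grading in which the images of all $v\in V$ are odd. (1) Every $\mathbb{Z}_2$-graded PBW deformation $R$ of $\Lambda_\mu(V)$ is a nontrivial skew Clifford algebra: there is a $\mu$-symmetric bilinear form $\varphi$ on $V$ such that $\mathrm{sCl}(V,\mu,\varphi)$ is nontrivial, together with an algebra isomorphism $R\cong\mathrm{sCl}(V,\mu,\varphi)$ that is compatible with the canonical maps from $V$. (2) Conversely, let $\varphi$ be a $\mu$-symmetric bilinear form on $V$ such that $\mathrm{sCl}(V,\mu,\varphi)$ is nontrivial. Then $\mathrm{sCl}(V,\mu,\varphi)$ is a PBW deformation of a quantum exterior algebra $\Lambda_{\mu'}(V')$, where $V'$ is the span of a subset $\mathcal B'$ of $\{x_1,\dots,x_n\}$ and $\mu'$ is the submatrix of $\mu$ with rows and columns indexed by $\mathcal B'$: there are such a $\mathcal B'$, a PBW deformation $T(V')/\langle P\rangle$ of $\Lambda_{\mu'}(V')$, and an algebra isomorphism $T(V')/\langle P\rangle\cong\mathrm{sCl}(V,\mu,\varphi)$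 that is compatible with the canonical maps from $V'$. -/

import Mathlib

open scoped DirectSum

namespace SkewClifford

/-! ### Filtered algebras and their associated graded algebras -/

/-- An increasing algebra filtration `F 0 ⊆ F 1 ⊆ ⋯` of a `k`-algebra `R` by
subspaces, with `1 ∈ F 0` and `F m * F n ⊆ F (m + n)`. -/
structure AlgFiltration (k R : Type*) [Field k] [Ring R] [Algebra k R] where
  /-- the `n`-th step of the filtration -/
  F : ℕ → Submodule k R
  mono : Monotone F
  one_mem : (1 : R) ∈ F 0
  mul_mem : ∀ {m n : ℕ} {x y : R}, x ∈ F m → y ∈ F n → x * y ∈ F (m + n)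

namespace AlgFiltration

variable {k R : Type*} [Field k] [Ring R] [Algebra k R]

/-- The previous step `F (n - 1)`, with the convention `F (-1) = 0`. -/
def prev (𝓕 : AlgFiltration k R) : ℕ → Submodule k R
  | 0 => ⊥
  | n + 1 => 𝓕.F n

/-- The `n`-th component `F n / F (n - 1)` of the associated graded algebra. -/
def GrPart (𝓕 : AlgFiltration k R) (n : ℕ) : Type _ :=
  𝓕.F n ⧸ (𝓕.prev n).submoduleOf (𝓕.F n)

instance (𝓕 : AlgFiltration k R) (n : ℕ) : AddCommGroup (𝓕.GrPart n) :=
  inferInstanceAs (AddCommGroup (𝓕.F n ⧸ (𝓕.prev n).submoduleOf (𝓕.F n)))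

instance (𝓕 : AlgFiltration k R) (n : ℕ) : Module k (𝓕.GrPart n) :=
  inferInstanceAs (Module k (𝓕.F n ⧸ (𝓕.prev n).submoduleOf (𝓕.F n)))

/-- The symbol map `F n → F n / F (n - 1)`. -/
def symb (𝓕 : AlgFiltration k R) (n : ℕ) : 𝓕.F n →ₗ[k] 𝓕.GrPart n :=
  Submodule.mkQ ((𝓕.prev n).submoduleOf (𝓕.F n))

theorem symb_surjective (𝓕 : AlgFiltration k R) (n : ℕ) : Function.Surjective (𝓕.symb n) :=
  Submodule.mkQ_surjective _

theorem symb_eq_zero (𝓕 : AlgFiltration k R) {n : ℕ} {x : 𝓕.F n} :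
    𝓕.symb n x = 0 ↔ (x : R) ∈ 𝓕.prev n :=
  (Submodule.Quotient.mk_eq_zero _).trans Iff.rfl

theorem prev_mul_mem (𝓕 : AlgFiltration k R) {m n : ℕ} {x y : R}
    (hx : x ∈ 𝓕.prev m) (hy : y ∈ 𝓕.F n) : x * y ∈ 𝓕.prev (m + n) := by
  cases m with
  | zero =>
    have h0 : x = 0 := by simpa [prev] using hx
    simp [h0]
  | succ m =>
    rw [Nat.succ_add]
    exact 𝓕.mul_mem hx hy

theorem mul_prev_mem (𝓕 : AlgFiltration k R) {m n : ℕ} {x y : R}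
    (hx : x ∈ 𝓕.F m) (hy : y ∈ 𝓕.prev n) : x * y ∈ 𝓕.prev (m + n) := by
  cases n with
  | zero =>
    have h0 : y = 0 := by simpa [prev] using hy
    simp [h0]
  | succ n => exact 𝓕.mul_mem hx hy

/-- The product of two elements of the filtration, as an element of the filtration. -/
def mulF (𝓕 : AlgFiltration k R) (m n : ℕ) : 𝓕.F m →ₗ[k] 𝓕.F n →ₗ[k] 𝓕.F (m + n) :=
  LinearMap.mk₂ k (fun x y => ⟨(x : R) * y, 𝓕.mul_mem x.2 y.2⟩)
    (fun _ _ _ => Subtype.ext (add_mul _ _ _))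
    (fun _ _ _ => Subtype.ext (smul_mul_assoc _ _ _))
    (fun _ _ _ => Subtype.ext (mul_add _ _ _))
    (fun _ _ _ => Subtype.ext (mul_smul_comm _ _ _))

/-- The product `F m / F (m - 1) × F n / F (n - 1) → F (m + n) / F (m + n - 1)` induced by the
product of `R`. -/
def grMul (𝓕 : AlgFiltration k R) (m n : ℕ) :
    𝓕.GrPart m →ₗ[k] 𝓕.GrPart n →ₗ[k] 𝓕.GrPart (m + n) :=
  Submodule.liftQ ((𝓕.prev m).submoduleOf (𝓕.F m))
    { toFun := fun x => Submodule.liftQ ((𝓕.prev n).submoduleOf (𝓕.F n)) ((𝓕.symb (m + n)).comp (𝓕.mulF m n x)) (by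
        intro y hy
        rw [LinearMap.mem_ker, LinearMap.comp_apply, symb_eq_zero]
        exact 𝓕.mul_prev_mem x.2 hy)
      map_add' := fun x x' => by
        refine LinearMap.ext fun y => ?_
        obtain ⟨y, rfl⟩ := 𝓕.symb_surjective n y
        change 𝓕.symb (m + n) (𝓕.mulF m n (x + x') y)
          = 𝓕.symb (m + n) (𝓕.mulF m n x y) + 𝓕.symb (m + n) (𝓕.mulF m n x' y)
        simp
      map_smul' := fun c x => by
        refine LinearMap.ext fun y => ?_
        obtain ⟨y, rfl⟩ := 𝓕.symb_surjective n y
        change 𝓕.symb (m + n) (𝓕.mulF m n (c • x) y) = c • 𝓕.symb (m + n) (𝓕.mulF m n x y)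
        simp }
    (by
      intro x hx
      rw [LinearMap.mem_ker]
      refine LinearMap.ext fun y => ?_
      obtain ⟨y, rfl⟩ := 𝓕.symb_surjective n y
      exact 𝓕.symb_eq_zero.2 (𝓕.prev_mul_mem hx y.2))

theorem grMul_symb (𝓕 : AlgFiltration k R) {m n : ℕ} (x : 𝓕.F m) (y : 𝓕.F n) :
    𝓕.grMul m n (𝓕.symb m x) (𝓕.symb n y)
      = 𝓕.symb (m + n) ⟨(x : R) * y, 𝓕.mul_mem x.2 y.2⟩ := rfl

theorem mk_symb_eq (𝓕 : AlgFiltration k R) {m n : ℕ} (h : m = n) (x : 𝓕.F m) (y : 𝓕.F n)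
    (hxy : (x : R) = y) :
    (GradedMonoid.mk m (𝓕.symb m x) : GradedMonoid 𝓕.GrPart) = GradedMonoid.mk n (𝓕.symb n y) := by
  subst h
  rw [Subtype.ext hxy]

instance (𝓕 : AlgFiltration k R) : GradedMonoid.GMul 𝓕.GrPart where
  mul x y := 𝓕.grMul _ _ x y

instance (𝓕 : AlgFiltration k R) : GradedMonoid.GOne 𝓕.GrPart where
  one := 𝓕.symb 0 ⟨1, 𝓕.one_mem⟩

instance (𝓕 : AlgFiltration k R) : DirectSum.GRing 𝓕.GrPart where
  one_mul := by
    rintro ⟨n, x⟩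
    obtain ⟨x, rfl⟩ := 𝓕.symb_surjective n x
    exact 𝓕.mk_symb_eq (zero_add n) _ _ (one_mul _)
  mul_one := by
    rintro ⟨n, x⟩
    obtain ⟨x, rfl⟩ := 𝓕.symb_surjective n x
    exact 𝓕.mk_symb_eq (add_zero n) _ _ (mul_one _)
  mul_assoc := by
    rintro ⟨m, x⟩ ⟨n, y⟩ ⟨l, z⟩
    obtain ⟨x, rfl⟩ := 𝓕.symb_surjective m x
    obtain ⟨y, rfl⟩ := 𝓕.symb_surjective n y
    obtain ⟨z, rfl⟩ := 𝓕.symb_surjective l z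
    exact 𝓕.mk_symb_eq (add_assoc m n l) _ _ (mul_assoc _ _ _)
  mul_zero := fun x => map_zero (𝓕.grMul _ _ x)
  zero_mul := fun y => by
    change 𝓕.grMul _ _ 0 y = 0
    simp
  mul_add := fun x y z => map_add (𝓕.grMul _ _ x) y z
  add_mul := fun x y z => by
    change 𝓕.grMul _ _ (x + y) z = 𝓕.grMul _ _ x z + 𝓕.grMul _ _ y z
    simp
  natCast := fun n => n • 𝓕.symb 0 ⟨1, 𝓕.one_mem⟩
  natCast_zero := zero_smul _ _
  natCast_succ := fun n => succ_nsmul _ n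
  intCast := fun n => n • 𝓕.symb 0 ⟨1, 𝓕.one_mem⟩
  intCast_ofNat := fun n => natCast_zsmul _ n
  intCast_negSucc_ofNat := fun n => negSucc_zsmul _ n

instance (𝓕 : AlgFiltration k R) : DirectSum.GAlgebra k 𝓕.GrPart where
  toFun :=
    { toFun := fun r => 𝓕.symb 0 (r • ⟨1, 𝓕.one_mem⟩)
      map_zero' := by rw [zero_smul, map_zero]
      map_add' := fun r s => by rw [add_smul, map_add] }
  map_one := congrArg (𝓕.symb 0) (one_smul _ _)
  map_mul := fun r s =>
    𝓕.mk_symb_eq (zero_add 0).symm ((r * s) • ⟨1, 𝓕.one_mem⟩)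
      ⟨(r • (1 : R)) * (s • (1 : R)), _⟩ (by simp [mul_smul, smul_comm r s])
  commutes := by
    rintro r ⟨n, x⟩
    obtain ⟨x, rfl⟩ := 𝓕.symb_surjective n x
    exact 𝓕.mk_symb_eq (by simp [add_comm]) ⟨(r • (1 : R)) * (x : R), _⟩
      ⟨(x : R) * (r • (1 : R)), _⟩ (by simp)
  smul_def := by
    rintro r ⟨n, x⟩
    obtain ⟨x, rfl⟩ := 𝓕.symb_surjective n x
    exact 𝓕.mk_symb_eq (zero_add n).symm (r • x) ⟨(r • (1 : R)) * (x : R), _⟩ (by simp)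

/-- The associated graded algebra `gr R = ⨁ₙ F n / F (n - 1)`. -/
abbrev Gr (𝓕 : AlgFiltration k R) : Type _ := ⨁ n, 𝓕.GrPart n

end AlgFiltration

/-! ### Quotients of tensor algebras -/

section

variable {k V : Type*} [Field k] [AddCommGroup V] [Module k V]

/-- The two-sided ideal `⟨S⟩` of the tensor algebra generated by a set `S`. -/
abbrev idealGen (S : Set (TensorAlgebra k V)) : Ideal (TensorAlgebra k V) :=
  (TwoSidedIdeal.span S).asIdeal

/-- The algebra `T(V) / ⟨S⟩`. -/
abbrev TQuot (S : Set (TensorAlgebra k V)) : Type _ := TensorAlgebra k V ⧸ idealGen S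

/-- The projection `T(V) → T(V) / ⟨S⟩`. -/
abbrev TQuot.mk (S : Set (TensorAlgebra k V)) : TensorAlgebra k V →ₐ[k] TQuot S :=
  Ideal.Quotient.mkₐ k (idealGen S)

/-- The canonical map `V → T(V) → T(V) / ⟨S⟩`. -/
def TQuot.gen (S : Set (TensorAlgebra k V)) : V →ₗ[k] TQuot S :=
  (TQuot.mk S).toLinearMap.comp (TensorAlgebra.ι k)

variable (k V) in
/-- The homogeneous component `T^n(V)` of the tensor algebra. -/
abbrev tPow (n : ℕ) : Submodule k (TensorAlgebra k V) :=
  LinearMap.range (TensorAlgebra.ι k : V →ₗ[k] TensorAlgebra k V) ^ n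

variable (k V) in
/-- The natural filtration `F^i T = ⨁_{j ≤ i} T^j(V)` of the tensor algebra. -/
def tFil (i : ℕ) : Submodule k (TensorAlgebra k V) := ⨆ j ≤ i, tPow k V j

theorem tPow_le_tFil {i j : ℕ} (h : j ≤ i) : tPow k V j ≤ tFil k V i :=
  le_iSup₂_of_le j h le_rfl

variable (k V) in
theorem tFil_mono : Monotone (tFil k V) := fun _ _ h =>
  iSup₂_le fun _ hj => tPow_le_tFil (hj.trans h)

theorem tFil_mul_le (m n : ℕ) : tFil k V m * tFil k V n ≤ tFil k V (m + n) := by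
  simp only [tFil, Submodule.iSup_mul, Submodule.mul_iSup]
  refine iSup₂_le fun j hj => iSup₂_le fun i hi => ?_
  rw [← pow_add]
  exact tPow_le_tFil (add_le_add hi hj)

/-- The filtration of `T(V) / ⟨S⟩` by the images of the `F^i T`. -/
def quotFil (S : Set (TensorAlgebra k V)) : AlgFiltration k (TQuot S) where
  F n := (tFil k V n).map (TQuot.mk S).toLinearMap
  mono := fun _ _ h => Submodule.map_mono (tFil_mono k V h)
  one_mem := ⟨1, tPow_le_tFil le_rfl (by simp), map_one (TQuot.mk S)⟩
  mul_mem := by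
    rintro m n _ _ ⟨x, hx, rfl⟩ ⟨y, hy, rfl⟩
    exact ⟨x * y, tFil_mul_le m n (Submodule.mul_mem_mul hx hy), map_mul (TQuot.mk S) x y⟩

theorem mk_mem_quotFil (S : Set (TensorAlgebra k V)) {n : ℕ} {t : TensorAlgebra k V}
    (ht : t ∈ tFil k V n) : TQuot.mk S t ∈ (quotFil S).F n :=
  ⟨t, ht, rfl⟩

theorem mem_tPow_one (v : V) : TensorAlgebra.ι k v ∈ tPow k V 1 := by simp

/-- The class in `F 1 / F 0` of a vector `v`. -/
def grι (S : Set (TensorAlgebra k V)) : V →ₗ[k] (quotFil S).GrPart 1 :=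
  ((quotFil S).symb 1).comp
    ((TQuot.gen S).codRestrict _ fun v => mk_mem_quotFil S (tPow_le_tFil le_rfl (mem_tPow_one v)))

/-- The natural algebra map `T(V) → gr (T(V) / ⟨S⟩)`, which sends `v ∈ V` to its class in
`F 1 / F 0`. -/
noncomputable def toGr (S : Set (TensorAlgebra k V)) :
    TensorAlgebra k V →ₐ[k] (quotFil S).Gr :=
  TensorAlgebra.lift k ((DirectSum.lof k ℕ (quotFil S).GrPart 1).comp (grι S))

/-- The natural map sends a homogeneous tensor of degree `n` to its class in `F n / F (n - 1)`. -/
theorem toGr_of_mem (S : Set (TensorAlgebra k V)) {n : ℕ} {t : TensorAlgebra k V}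
    (ht : t ∈ tPow k V n) :
    toGr S t = DirectSum.of (quotFil S).GrPart n
      ((quotFil S).symb n ⟨TQuot.mk S t, mk_mem_quotFil S (tPow_le_tFil le_rfl ht)⟩) := by
  induction ht using Submodule.pow_induction_on_left' with
  | algebraMap r =>
    rw [AlgHom.commutes, DirectSum.algebraMap_apply]
    refine DirectSum.of_eq_of_gradedMonoid_eq ((quotFil S).mk_symb_eq rfl
      (r • ⟨1, (quotFil S).one_mem⟩) _ ?_)
    change r • (1 : TQuot S) = TQuot.mk S _
    rw [AlgHom.commutes, Algebra.algebraMap_eq_smul_one]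
  | add x y i hx hy ihx ihy =>
    rw [map_add, ihx, ihy, ← map_add, ← map_add]
    rfl
  | mem_mul m hm i x hx ih =>
    obtain ⟨v, rfl⟩ := hm
    rw [map_mul, ih, toGr, TensorAlgebra.lift_ι_apply]
    refine (DirectSum.of_mul_of _ _).trans ?_
    exact DirectSum.of_eq_of_gradedMonoid_eq ((quotFil S).mk_symb_eq (add_comm 1 i) _ _
      (map_mul (TQuot.mk S) _ _).symm)

/-- The projection `π` of the tensor algebra onto its degree two component `V ⊗ V`. -/
noncomputable def proj₂ : TensorAlgebra k V →ₗ[k] TensorAlgebra k V :=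
  GradedAlgebra.proj (tPow k V) 2

end

/-! ### Skew Clifford algebras and their relation with quantum exterior algebras -/

section

variable {k V ι : Type*} [Field k] [AddCommGroup V] [Module k V]

/-- `μ` is multiplicatively antisymmetric. -/
def IsMulAntisymm (μ : Matrix ι ι k) : Prop :=
  ∀ i j, μ i j * μ j i = 1 ∧ μ i i = 1

/-- The bilinear form `φ` is `μ`-symmetric relative to the basis `b`. -/
def IsMuSymm (b : Module.Basis ι k V) (μ : Matrix ι ι k) (φ : LinearMap.BilinForm k V) : Prop :=
  ∀ i j, φ (b i) (b j) = μ i j * φ (b j) (b i)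

/-- The element `xᵢ ⊗ xⱼ + μᵢⱼ xⱼ ⊗ xᵢ - 2 φ(xᵢ, xⱼ)` of the tensor algebra. -/
noncomputable def rel (b : Module.Basis ι k V) (μ : Matrix ι ι k) (φ : LinearMap.BilinForm k V) (i j : ι) :
    TensorAlgebra k V :=
  TensorAlgebra.ι k (b i) * TensorAlgebra.ι k (b j)
    + μ i j • (TensorAlgebra.ι k (b j) * TensorAlgebra.ι k (b i))
    - algebraMap k (TensorAlgebra k V) (2 * φ (b i) (b j))

/-- The set of all defining relations of the skew Clifford algebra. -/
def rels (b : Module.Basis ι k V) (μ : Matrix ι ι k) (φ : LinearMap.BilinForm k V) :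
    Set (TensorAlgebra k V) :=
  {t | ∃ i j, t = rel b μ φ i j}

/-- The skew Clifford algebra `sCl(V, μ, φ)`. -/
abbrev SCl (b : Module.Basis ι k V) (μ : Matrix ι ι k) (φ : LinearMap.BilinForm k V) : Type _ :=
  TQuot (rels b μ φ)

/-- The canonical map `g : V → sCl(V, μ, φ)`. -/
abbrev SCl.g (b : Module.Basis ι k V) (μ : Matrix ι ι k) (φ : LinearMap.BilinForm k V) :
    V →ₗ[k] SCl b μ φ :=
  TQuot.gen (rels b μ φ)

/-- The quantum exterior algebra `Λ_μ(V) = sCl(V, μ, 0)`. -/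
abbrev QExt (b : Module.Basis ι k V) (μ : Matrix ι ι k) : Type _ := SCl b μ 0

/-- `T(V) / ⟨P⟩`, for a subspace `P` of `F²T`, is a nonhomogeneous quadratic algebra obtained by
deforming the relations of `Λ_μ(V)`: the projection of `P` to `V ⊗ V` is the space of defining
relations of `Λ_μ(V)`. -/
structure IsDeformation (b : Module.Basis ι k V) (μ : Matrix ι ι k)
    (P : Submodule k (TensorAlgebra k V)) : Prop where
  le : P ≤ tFil k V 2
  proj : P.map proj₂ = Submodule.span k (rels b μ 0)

theorem IsDeformation.toGr_eq_zero {b : Module.Basis ι k V} {μ : Matrix ι ι k}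
    {P : Submodule k (TensorAlgebra k V)} (h : IsDeformation b μ P) {t : TensorAlgebra k V}
    (ht : t ∈ idealGen (rels b μ 0)) : toGr (P : Set (TensorAlgebra k V)) t = 0 := by
  have key : TwoSidedIdeal.span (rels b μ 0)
      ≤ TwoSidedIdeal.ker (toGr (P : Set (TensorAlgebra k V))) := by
    rw [TwoSidedIdeal.span_le]
    intro q hq
    rw [SetLike.mem_coe, TwoSidedIdeal.mem_ker]
    have hq' : q ∈ P.map proj₂ := h.proj ▸ Submodule.subset_span hq
    obtain ⟨p, hp, rfl⟩ := hq'
    have hmem : (proj₂ p : TensorAlgebra k V) ∈ tPow k V 2 := by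
      simp [proj₂, GradedAlgebra.proj_apply]
    rw [toGr_of_mem _ hmem]
    have hz : (quotFil (P : Set (TensorAlgebra k V))).symb 2
        ⟨TQuot.mk _ (proj₂ p), mk_mem_quotFil _ (tPow_le_tFil le_rfl hmem)⟩ = 0 := by
      rw [AlgFiltration.symb_eq_zero]
      have hlow : ∀ x ∈ tFil k V 2, x - proj₂ x ∈ tFil k V 1 := by
        intro x hx
        have hle : tFil k V 2 ≤ (tFil k V 1).comap (LinearMap.id - proj₂) := by
          refine iSup₂_le fun j hj y hy => ?_
          rw [Submodule.mem_comap, LinearMap.sub_apply, LinearMap.id_apply, proj₂,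
            GradedAlgebra.proj_apply]
          rcases Nat.lt_or_ge j 2 with hj2 | hj2
          · rw [DirectSum.decompose_of_mem_ne (tPow k V) hy (by omega), sub_zero]
            exact tPow_le_tFil (by omega) hy
          · obtain rfl : j = 2 := le_antisymm hj hj2
            rw [DirectSum.decompose_of_mem_same (tPow k V) hy, sub_self]
            exact zero_mem _
        exact hle hx
      have hp0 : TQuot.mk (P : Set (TensorAlgebra k V)) p = 0 :=
        Ideal.Quotient.eq_zero_iff_mem.2 (TwoSidedIdeal.subset_span hp)
      have heq : TQuot.mk (P : Set (TensorAlgebra k V)) (proj₂ p)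
          = - TQuot.mk (P : Set (TensorAlgebra k V)) (p - proj₂ p) := by
        rw [map_sub, hp0, zero_sub, neg_neg]
      change TQuot.mk (P : Set (TensorAlgebra k V)) (proj₂ p) ∈ (quotFil _).F 1
      rw [heq]
      exact neg_mem (mk_mem_quotFil _ (hlow p (h.le hp)))
    rw [hz, map_zero]
  exact (TwoSidedIdeal.mem_ker _).1 (key ht)

/-- The natural projection `Λ_μ(V) → gr (T(V) / ⟨P⟩)`, `xᵢ ↦ [xᵢ] ∈ F 1 / F 0`. -/
noncomputable def IsDeformation.toGr {b : Module.Basis ι k V} {μ : Matrix ι ι k}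
    {P : Submodule k (TensorAlgebra k V)} (h : IsDeformation b μ P) :
    QExt b μ →ₐ[k] (quotFil (P : Set (TensorAlgebra k V))).Gr :=
  Ideal.Quotient.liftₐ (idealGen (rels b μ 0)) (SkewClifford.toGr (P : Set (TensorAlgebra k V)))
    fun _ ht => h.toGr_eq_zero ht

/-- `T(V) / ⟨P⟩` is a PBW deformation of the quantum exterior algebra `Λ_μ(V)`. -/
def IsPBWDeformation (b : Module.Basis ι k V) (μ : Matrix ι ι k)
    (P : Submodule k (TensorAlgebra k V)) : Prop :=
  ∃ h : IsDeformation b μ P, Function.Bijective h.toGr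

/-- `T(V) / ⟨P⟩` is `ℤ/2`-graded, the generators `v ∈ V` being odd. -/
def IsZ2Graded (P : Submodule k (TensorAlgebra k V)) : Prop :=
  ∃ 𝒜 : ZMod 2 → Submodule k (TQuot (P : Set (TensorAlgebra k V))),
    Nonempty (GradedAlgebra 𝒜) ∧ ∀ v : V, TQuot.gen (P : Set (TensorAlgebra k V)) v ∈ 𝒜 1

/-- The basis of the subspace spanned by the basis vectors with index in `s`. -/
noncomputable def subBasis (b : Module.Basis ι k V) (s : Set ι) :
    Module.Basis s k (Submodule.span k (Set.range fun i : s => b i)) :=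
  Module.Basis.span (b.linearIndependent.comp (fun i : s => (i : ι))
    Subtype.val_injective)

end

end SkewClifford

/-! Both halves rest on comparing leading terms. For (1), injectivity of Λ_μ(V) → gr(R) means that R
has no relations in F¹T = k ⊕ V, because Λ_μ(V) has none (`IsDeformation.eq_zero_of_mk_eq_zero`). In
a ℤ/2-graded R the linear part of a relation is both odd and even, hence zero in R, hence zero in V.
So every relation is a quadratic one minus a scalar; halving the scalars gives φ, and the absence of
relations in F¹T yields both the μ-symmetry of φ and P = span of `rels b μ φ`.

For (2), the obstruction to PBW is `IsCompatible`: φ(x_j, x_l) ≠ 0 must force μ_ij μ_il = 1. When it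
holds, there are skew derivations ∂_i of Λ_μ(V) with ∂_i(x_j) = φ(x_i, x_j), and sCl(V, μ, φ) acts
on Λ_μ(V) through x_i ↦ (left multiplication by x_i) + ∂_i. Acting on 1 recovers the leading term of
a tensor, so no leading term outside the ideal of Λ_μ(V) is lost, which is PBW
(`isPBWDeformation_of_isCompatible`).

In general, computing x_i x_j x_l in two ways gives a linear relation among the three generators
(`overlap_eq_zero`). If the generators are nonzero and pairwise non-proportional in sCl, these
relations imply compatibility (`mul_eq_one_of_ne_smul`). It remains to keep one generator from each
nonzero line of generators and to show that this does not change the algebra (`exists_reduction`).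
-/

namespace SkewClifford

/-! ### Quotients of tensor algebras and their homogeneous components. -/

section TensorQuotients

variable {k V ι : Type*} [Field k] [AddCommGroup V] [Module k V]

noncomputable instance TQuot.instModule (S : Set (TensorAlgebra k V)) : Module k (TQuot S) :=
  Algebra.toModule

noncomputable instance TQuot.instSMul (S : Set (TensorAlgebra k V)) : SMul k (TQuot S) :=
  Algebra.toSMul

theorem eq_zero_of_mem_idealGen {A : Type*} [Ring A] [Algebra k A] {S : Set (TensorAlgebra k V)}
    (f : TensorAlgebra k V →ₐ[k] A) (h : ∀ t ∈ S, f t = 0) {t : TensorAlgebra k V}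
    (ht : t ∈ idealGen S) : f t = 0 := by
  have key : TwoSidedIdeal.span S ≤ TwoSidedIdeal.ker f := by
    rw [TwoSidedIdeal.span_le]
    intro q hq
    rw [SetLike.mem_coe, TwoSidedIdeal.mem_ker]
    exact h q hq
  exact (TwoSidedIdeal.mem_ker _).1 (key ht)

/-- The universal property of `T(V) / ⟨S⟩`. -/
noncomputable def TQuot.lift {A : Type*} [Ring A] [Algebra k A] (S : Set (TensorAlgebra k V))
    (f : TensorAlgebra k V →ₐ[k] A) (h : ∀ t ∈ S, f t = 0) : TQuot S →ₐ[k] A :=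
  Ideal.Quotient.liftₐ (idealGen S) f fun _ ht => eq_zero_of_mem_idealGen f h ht

@[simp]
theorem TQuot.lift_gen {A : Type*} [Ring A] [Algebra k A] (S : Set (TensorAlgebra k V))
    (f : TensorAlgebra k V →ₐ[k] A) (h : ∀ t ∈ S, f t = 0) (v : V) :
    TQuot.lift S f h (TQuot.gen S v) = f (TensorAlgebra.ι k v) := rfl

theorem TQuot.mk_ι (S : Set (TensorAlgebra k V)) (v : V) :
    TQuot.mk S (TensorAlgebra.ι k v) = TQuot.gen S v := rfl

theorem TQuot.mk_surjective (S : Set (TensorAlgebra k V)) : Function.Surjective (TQuot.mk S) :=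
  Ideal.Quotient.mk_surjective

theorem TQuot.mk_eq_zero_iff {S : Set (TensorAlgebra k V)} {t : TensorAlgebra k V} :
    TQuot.mk S t = 0 ↔ t ∈ idealGen S :=
  Ideal.Quotient.eq_zero_iff_mem

theorem TQuot.mk_eq_zero_of_mem {S : Set (TensorAlgebra k V)} {t : TensorAlgebra k V}
    (ht : t ∈ S) : TQuot.mk S t = 0 :=
  TQuot.mk_eq_zero_iff.2 (TwoSidedIdeal.subset_span ht)

theorem TQuot.algHom_ext {A : Type*} [Ring A] [Algebra k A] {S : Set (TensorAlgebra k V)}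
    (b : Module.Basis ι k V) {f g : TQuot S →ₐ[k] A}
    (h : ∀ i, f (TQuot.gen S (b i)) = g (TQuot.gen S (b i))) : f = g := by
  have h1 : f.comp (TQuot.mk S) = g.comp (TQuot.mk S) := by
    apply TensorAlgebra.hom_ext
    refine b.ext fun i => ?_
    exact h i
  refine AlgHom.ext fun x => ?_
  obtain ⟨t, rfl⟩ := TQuot.mk_surjective S x
  exact DFunLike.congr_fun h1 t

/-- Deformations are presented by a subspace and skew Clifford algebras by a set of relations; this
is the passage between the two. -/
theorem idealGen_span (S : Set (TensorAlgebra k V)) :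
    idealGen (Submodule.span k S : Set (TensorAlgebra k V)) = idealGen S := by
  have h : TwoSidedIdeal.span (Submodule.span k S : Set (TensorAlgebra k V))
      = TwoSidedIdeal.span S := by
    apply le_antisymm
    · rw [TwoSidedIdeal.span_le]
      intro p hp
      have : Submodule.span k S ≤ (LinearMap.ker (TQuot.mk S).toLinearMap) :=
        Submodule.span_le.2 fun t ht => TQuot.mk_eq_zero_of_mem ht
      exact TQuot.mk_eq_zero_iff.1 (this hp)
    · exact TwoSidedIdeal.span_mono Submodule.subset_span
  rw [idealGen, h]

/-- Generating sets with the same linear span define the same algebra. -/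
noncomputable def TQuot.spanEquiv {P : Submodule k (TensorAlgebra k V)}
    {S : Set (TensorAlgebra k V)} (h : P = Submodule.span k S) :
    TQuot (P : Set (TensorAlgebra k V)) ≃ₐ[k] TQuot S :=
  Ideal.quotientEquivAlgOfEq k (by rw [h, idealGen_span])

theorem TQuot.spanEquiv_gen {P : Submodule k (TensorAlgebra k V)}
    {S : Set (TensorAlgebra k V)} (h : P = Submodule.span k S) (v : V) :
    TQuot.spanEquiv h (TQuot.gen (P : Set (TensorAlgebra k V)) v) = TQuot.gen S v := rfl

/-- A subspace of `T(V)` which contains `1` and is stable under left multiplication by the basis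
vectors is everything. -/
theorem eq_top_of_ι_mul_mem (b : Module.Basis ι k V) (M : Submodule k (TensorAlgebra k V))
    (h1 : (1 : TensorAlgebra k V) ∈ M)
    (hb : ∀ i, ∀ t ∈ M, TensorAlgebra.ι k (b i) * t ∈ M) : M = ⊤ := by
  have hv : ∀ v : V, ∀ t ∈ M, TensorAlgebra.ι k v * t ∈ M := by
    intro v t ht
    have : (⊤ : Submodule k V) ≤ M.comap ((LinearMap.mulRight k t).comp (TensorAlgebra.ι k)) := by
      rw [← b.span_eq, Submodule.span_le]
      rintro _ ⟨i, rfl⟩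
      exact hb i t ht
    exact this (Submodule.mem_top (x := v))
  refine eq_top_iff.2 fun t _ => ?_
  suffices h : ∀ s ∈ M, t * s ∈ M by simpa using h 1 h1
  clear * - hv
  induction t using TensorAlgebra.induction with
  | algebraMap r => intro s hs; rw [← Algebra.smul_def]; exact M.smul_mem r hs
  | ι v => exact hv v
  | mul x y hx hy => intro s hs; rw [mul_assoc]; exact hx (y * s) (hy s hs)
  | add x y hx hy => intro s hs; rw [add_mul]; exact M.add_mem (hx s hs) (hy s hs)

/-- A subspace of `T(V) / ⟨S⟩` which contains `1` and is stable under left multiplication by the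
basis vectors is everything. -/
theorem TQuot.left_induction (b : Module.Basis ι k V) (S : Set (TensorAlgebra k V))
    (M : Submodule k (TQuot S)) (h1 : (1 : TQuot S) ∈ M)
    (hb : ∀ i, ∀ t ∈ M, TQuot.gen S (b i) * t ∈ M) (x : TQuot S) : x ∈ M := by
  obtain ⟨t, rfl⟩ := TQuot.mk_surjective S x
  have := eq_top_of_ι_mul_mem b (M.comap (TQuot.mk S).toLinearMap)
    (by simpa using h1) (fun i t ht => by
      have := hb i _ ht
      simpa [← TQuot.mk_ι] using this)
  have h2 : t ∈ M.comap (TQuot.mk S).toLinearMap := this ▸ Submodule.mem_top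
  exact h2

/-! ### Homogeneous components -/

theorem proj_mem_tPow (n : ℕ) (t : TensorAlgebra k V) :
    GradedAlgebra.proj (tPow k V) n t ∈ tPow k V n := by
  simp [GradedAlgebra.proj_apply]

theorem proj_of_mem {n : ℕ} {t : TensorAlgebra k V} (ht : t ∈ tPow k V n) :
    GradedAlgebra.proj (tPow k V) n t = t := by
  rw [GradedAlgebra.proj_apply, DirectSum.decompose_of_mem_same _ ht]

theorem proj_of_mem_ne {m n : ℕ} (h : m ≠ n) {t : TensorAlgebra k V} (ht : t ∈ tPow k V m) :
    GradedAlgebra.proj (tPow k V) n t = 0 := by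
  rw [GradedAlgebra.proj_apply, DirectSum.decompose_of_mem_ne _ ht h]

theorem sum_proj (t : TensorAlgebra k V) :
    ∃ s : Finset ℕ, ∑ n ∈ s, GradedAlgebra.proj (tPow k V) n t = t := by
  classical
  exact ⟨_, DirectSum.sum_support_decompose (tPow k V) t⟩

theorem sub_proj_mem_tFil {n : ℕ} {t : TensorAlgebra k V} (ht : t ∈ tFil k V (n + 1)) :
    t - GradedAlgebra.proj (tPow k V) (n + 1) t ∈ tFil k V n := by
  have hle : tFil k V (n + 1) ≤
      (tFil k V n).comap (LinearMap.id - GradedAlgebra.proj (tPow k V) (n + 1)) := by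
    refine iSup₂_le fun j hj y hy => ?_
    rw [Submodule.mem_comap, LinearMap.sub_apply, LinearMap.id_apply]
    rcases Nat.lt_or_ge j (n + 1) with hj2 | hj2
    · rw [proj_of_mem_ne (by omega) hy, sub_zero]
      exact tPow_le_tFil (by omega) hy
    · obtain rfl : j = n + 1 := le_antisymm hj hj2
      rw [proj_of_mem hy, sub_self]
      exact zero_mem _
  exact hle ht

theorem mem_tFil_one {t : TensorAlgebra k V} (ht : t ∈ tFil k V 1) :
    ∃ (c : k) (v : V), t = algebraMap k _ c + TensorAlgebra.ι k v := by
  have h0 := sub_proj_mem_tFil ht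
  have h1 := proj_mem_tPow 1 t
  rw [tPow, pow_one] at h1
  obtain ⟨v, hv⟩ := h1
  have h2 : tFil k V 0 ≤ 1 := iSup₂_le fun j hj => by
    obtain rfl : j = 0 := by omega
    simp [tPow]
  obtain ⟨c, hc⟩ := Submodule.mem_one.1 (h2 h0)
  exact ⟨c, v, by rw [hc, hv]; simp⟩

theorem rel_eq (b : Module.Basis ι k V) (μ : Matrix ι ι k) (φ : LinearMap.BilinForm k V) (i j : ι) :
    rel b μ φ i j = rel b μ 0 i j - algebraMap k _ (2 * φ (b i) (b j)) := by
  simp [rel]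

theorem rel_zero_mem_tPow (b : Module.Basis ι k V) (μ : Matrix ι ι k) (i j : ι) :
    rel b μ 0 i j ∈ tPow k V 2 := by
  have h : ∀ u v : V, TensorAlgebra.ι k u * TensorAlgebra.ι k v ∈ tPow k V 2 := fun u v => by
    rw [tPow, pow_two]
    exact Submodule.mul_mem_mul ⟨u, rfl⟩ ⟨v, rfl⟩
  have : rel b μ 0 i j = TensorAlgebra.ι k (b i) * TensorAlgebra.ι k (b j)
    + μ i j • (TensorAlgebra.ι k (b j) * TensorAlgebra.ι k (b i)) := by simp [rel]
  rw [this]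
  exact add_mem (h _ _) (Submodule.smul_mem _ _ (h _ _))

theorem algebraMap_mem_tPow (c : k) : algebraMap k (TensorAlgebra k V) c ∈ tPow k V 0 := by
  rw [tPow, pow_zero]; exact Submodule.mem_one.2 ⟨c, rfl⟩

theorem proj₂_rel (b : Module.Basis ι k V) (μ : Matrix ι ι k) (φ : LinearMap.BilinForm k V)
    (i j : ι) : proj₂ (rel b μ φ i j) = rel b μ 0 i j := by
  rw [rel_eq, proj₂, map_sub, proj_of_mem (rel_zero_mem_tPow b μ i j),
    proj_of_mem_ne (by norm_num) (algebraMap_mem_tPow _), sub_zero]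

/-- The form enters the relations only in degree zero, so π strips it off. -/
theorem isDeformation_span_rels (b : Module.Basis ι k V) (μ : Matrix ι ι k)
    (φ : LinearMap.BilinForm k V) : IsDeformation b μ (Submodule.span k (rels b μ φ)) where
  le := by
    rw [Submodule.span_le]
    rintro _ ⟨i, j, rfl⟩
    rw [rel_eq]
    exact sub_mem (tPow_le_tFil le_rfl (rel_zero_mem_tPow b μ i j))
      (tPow_le_tFil (by norm_num) (algebraMap_mem_tPow _))
  proj := by
    rw [Submodule.map_span]
    congr 1
    ext t
    constructor
    · rintro ⟨_, ⟨i, j, rfl⟩, rfl⟩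
      exact ⟨i, j, proj₂_rel b μ φ i j⟩
    · rintro ⟨i, j, rfl⟩
      exact ⟨_, ⟨i, j, rfl⟩, proj₂_rel b μ φ i j⟩

end TensorQuotients

/-! ### Universal property of skew Clifford algebras. -/

section

variable {k V ι : Type*} [Field k] [AddCommGroup V] [Module k V]

/-- An algebra map out of the tensor algebra determined by elements `x i` satisfying the relations
of a skew Clifford algebra kills the defining relations. -/
theorem map_rel {A : Type*} [Ring A] [Algebra k A] (b : Module.Basis ι k V) (μ : Matrix ι ι k)
    (φ : LinearMap.BilinForm k V) (f : TensorAlgebra k V →ₐ[k] A)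
    (h : ∀ i j, f (TensorAlgebra.ι k (b i)) * f (TensorAlgebra.ι k (b j))
      + μ i j • (f (TensorAlgebra.ι k (b j)) * f (TensorAlgebra.ι k (b i)))
      = algebraMap k A (2 * φ (b i) (b j))) :
    ∀ t ∈ rels b μ φ, f t = 0 := by
  rintro _ ⟨i, j, rfl⟩
  rw [rel, map_sub, map_add, map_smul, map_mul, map_mul, AlgHom.commutes, h, sub_self]

theorem SCl.g_mul_g (b : Module.Basis ι k V) (μ : Matrix ι ι k) (φ : LinearMap.BilinForm k V)
    (i j : ι) : SCl.g b μ φ (b i) * SCl.g b μ φ (b j)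
      + μ i j • (SCl.g b μ φ (b j) * SCl.g b μ φ (b i))
      = algebraMap k (SCl b μ φ) (2 * φ (b i) (b j)) := by
  have h : TQuot.mk (rels b μ φ) (rel b μ φ i j) = 0 := TQuot.mk_eq_zero_of_mem ⟨i, j, rfl⟩
  rw [rel, map_sub, map_add, map_smul, map_mul, map_mul, AlgHom.commutes, sub_eq_zero] at h
  exact h

/-- The algebra map out of a skew Clifford algebra determined by elements `x i` which satisfy its
relations. -/
noncomputable def SCl.lift {A : Type*} [Ring A] [Algebra k A] (b : Module.Basis ι k V)
    (μ : Matrix ι ι k) (φ : LinearMap.BilinForm k V) (x : ι → A)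
    (h : ∀ i j, x i * x j + μ i j • (x j * x i) = algebraMap k A (2 * φ (b i) (b j))) :
    SCl b μ φ →ₐ[k] A :=
  TQuot.lift (rels b μ φ) (TensorAlgebra.lift k (b.constr k x))
    (map_rel b μ φ _ fun i j => by simpa using h i j)

@[simp]
theorem SCl.lift_g {A : Type*} [Ring A] [Algebra k A] (b : Module.Basis ι k V)
    (μ : Matrix ι ι k) (φ : LinearMap.BilinForm k V) (x : ι → A)
    (h : ∀ i j, x i * x j + μ i j • (x j * x i) = algebraMap k A (2 * φ (b i) (b j))) (i : ι) :
    SCl.lift b μ φ x h (SCl.g b μ φ (b i)) = x i := by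
  rw [SCl.lift, SCl.g, TQuot.lift_gen, TensorAlgebra.lift_ι_apply, Module.Basis.constr_basis]

end


/-! ### The action of a skew Clifford algebra on the quantum exterior algebra. -/

section PBW

variable {k V ι : Type*} [Field k] [AddCommGroup V] [Module k V]

/-- The compatibility of a bilinear form with `μ` which makes the overlaps of the relations of the
skew Clifford algebra resolvable. -/
def IsCompatible (b : Module.Basis ι k V) (μ : Matrix ι ι k) (φ : LinearMap.BilinForm k V) :
    Prop :=
  ∀ i j l, φ (b j) (b l) ≠ 0 → μ i j * μ i l = 1

variable {b : Module.Basis ι k V} {μ : Matrix ι ι k} {φ : LinearMap.BilinForm k V}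

theorem QExt.g_mul_g (b : Module.Basis ι k V) (μ : Matrix ι ι k) (i j : ι) :
    SCl.g b μ 0 (b i) * SCl.g b μ 0 (b j) + μ i j • (SCl.g b μ 0 (b j) * SCl.g b μ 0 (b i)) = 0 := by
  simpa using SCl.g_mul_g b μ 0 i j

/-- Together with `IsCompatible.mul_sub`, this turns compatibility into vanishing coefficients,
usable in linear identities without splitting cases. -/
theorem IsCompatible.mul_sub_left (hC : IsCompatible b μ φ) (i j l : ι) :
    φ (b j) (b l) * (1 - μ i j * μ i l) = 0 := by
  by_cases h : φ (b j) (b l) = 0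
  · simp [h]
  · simp [hC i j l h]

theorem IsCompatible.mul_sub (hμ : IsMulAntisymm μ) (hC : IsCompatible b μ φ) (i j l : ι) :
    φ (b i) (b l) * (μ j l - μ i j) = 0 := by
  by_cases h : φ (b i) (b l) = 0
  · simp [h]
  · have h1 := hC j i l h
    have h2 := (hμ i j).1
    have : μ j l = μ i j := by
      linear_combination μ i j * h1 - μ j l * h2
    simp [this]

/-- The triangular matrices which encode the skew derivation `∂ᵢ` of the quantum exterior algebra
with `∂ᵢ(xⱼ) = φ(xᵢ, xⱼ)`. -/
noncomputable def derivMatrix (hμ : IsMulAntisymm μ) (hC : IsCompatible b μ φ) (i : ι) :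
    QExt b μ →ₐ[k] Matrix (Fin 2) (Fin 2) (QExt b μ) :=
  -- With σ(x_j) = -μ_ij x_j, matrices with rows (σ(x), ∂x) and (0, x) multiply with upper right
  -- entry σ(x) ∂y + ∂x · y. A homomorphism of this shape is thus a σ-derivation, and only the
  -- quadratic relations need checking.
  SCl.lift b μ 0 (fun j => !![(-μ i j) • SCl.g b μ 0 (b j), algebraMap k _ (φ (b i) (b j));
      0, SCl.g b μ 0 (b j)]) (fun j l => by
    have h := QExt.g_mul_g b μ j l
    have h1 := hC.mul_sub_left l i j
    have h2 := hC.mul_sub hμ i j l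
    have h3 := (hμ i l).1
    have h4 : φ (b i) (b j) * (1 - μ i l * μ j l) = 0 := by
      have := (hμ j l).1
      linear_combination -(μ i l * μ j l) * h1 - φ (b i) (b j) * h3
        - φ (b i) (b j) * μ i l * μ l i * this
    simp only [LinearMap.zero_apply, mul_zero, map_zero]
    generalize SCl.g b μ 0 (b j) = x at *
    generalize SCl.g b μ 0 (b l) = y at *
    ext p q
    fin_cases p <;> fin_cases q
    · have : (μ i j * μ i l) • (x * y + μ j l • (y * x)) = 0 := by rw [h, smul_zero]
      simp [-neg_smul]
      rw [← this]
      module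
    -- This off-diagonal entry is where compatibility is needed: both coefficients vanish because of
    -- it.
    · have : (φ (b i) (b j) * (1 - μ i l * μ j l)) • y + (φ (b i) (b l) * (μ j l - μ i j)) • x = 0 := by
        rw [h4, h2, zero_smul, zero_smul, add_zero]
      simp [Algebra.algebraMap_eq_smul_one]
      rw [← this]
      module
    · simp
    · simpa using h)

theorem derivMatrix_g (hμ : IsMulAntisymm μ) (hC : IsCompatible b μ φ) (i j : ι) :
    derivMatrix hμ hC i (SCl.g b μ 0 (b j)) =
      !![(-μ i j) • SCl.g b μ 0 (b j), algebraMap k _ (φ (b i) (b j)); 0, SCl.g b μ 0 (b j)] :=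
  SCl.lift_g b μ 0 _ _ j

theorem derivMatrix_one_one (hμ : IsMulAntisymm μ) (hC : IsCompatible b μ φ) (i : ι)
    (w : QExt b μ) : derivMatrix hμ hC i w 1 1 = w := by
  refine TQuot.left_induction b _ (LinearMap.eqLocus
    ((Matrix.entryLinearMap k (QExt b μ) (1 : Fin 2) (1 : Fin 2)).comp
      (derivMatrix hμ hC i).toLinearMap) LinearMap.id) ?_ ?_ w
  · simp [LinearMap.mem_eqLocus]
  · intro j t ht
    simp only [LinearMap.mem_eqLocus, LinearMap.comp_apply, AlgHom.toLinearMap_apply,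
      Matrix.entryLinearMap_apply, LinearMap.id_apply] at ht ⊢
    rw [map_mul, derivMatrix_g, Matrix.mul_apply, Fin.sum_univ_two, ht]
    simp

/-- The skew derivation `∂ᵢ` of the quantum exterior algebra with `∂ᵢ(xⱼ) = φ(xᵢ, xⱼ)`. -/
noncomputable def skewDeriv (hμ : IsMulAntisymm μ) (hC : IsCompatible b μ φ) (i : ι) :
    QExt b μ →ₗ[k] QExt b μ :=
  (Matrix.entryLinearMap k (QExt b μ) (0 : Fin 2) (1 : Fin 2)).comp
    (derivMatrix hμ hC i).toLinearMap

theorem skewDeriv_one (hμ : IsMulAntisymm μ) (hC : IsCompatible b μ φ) (i : ι) :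
    skewDeriv hμ hC i 1 = 0 := by
  simp [skewDeriv]

/-- The skew Leibniz rule, read off the upper right entry of a product of matrices. -/
theorem skewDeriv_g_mul (hμ : IsMulAntisymm μ) (hC : IsCompatible b μ φ) (i j : ι)
    (w : QExt b μ) : skewDeriv hμ hC i (SCl.g b μ 0 (b j) * w) =
      φ (b i) (b j) • w - μ i j • (SCl.g b μ 0 (b j) * skewDeriv hμ hC i w) := by
  simp only [skewDeriv, LinearMap.comp_apply, AlgHom.toLinearMap_apply,
    Matrix.entryLinearMap_apply]
  rw [map_mul, derivMatrix_g, Matrix.mul_apply, Fin.sum_univ_two, derivMatrix_one_one,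
    Algebra.smul_def (φ (b i) (b j))]
  simp only [Matrix.of_apply, Matrix.cons_val', Matrix.cons_val_zero, Matrix.cons_val_one,
    Matrix.cons_val_fin_one, smul_mul_assoc]
  module

/-- By induction on `w`: after two uses of the Leibniz rule on x_l t, the terms free of x_l have
coefficients that vanish by compatibility, and the rest is a multiple of x_l times the identity for
t. -/
theorem skewDeriv_comm (hμ : IsMulAntisymm μ) (hC : IsCompatible b μ φ) (i j : ι)
    (w : QExt b μ) : skewDeriv hμ hC i (skewDeriv hμ hC j w)
      + μ i j • skewDeriv hμ hC j (skewDeriv hμ hC i w) = 0 := by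
  refine TQuot.left_induction b _ (LinearMap.ker
    ((skewDeriv hμ hC i).comp (skewDeriv hμ hC j)
      + μ i j • (skewDeriv hμ hC j).comp (skewDeriv hμ hC i))) ?_ ?_ w
  · simp [skewDeriv_one]
  · intro l t ht
    simp only [LinearMap.mem_ker, LinearMap.add_apply, LinearMap.smul_apply,
      LinearMap.comp_apply] at ht ⊢
    have e : TQuot.gen (rels b μ 0) (b l) = SCl.g b μ 0 (b l) := rfl
    rw [e]
    have h1 := hC.mul_sub_left i j l
    have h2 := hC.mul_sub hμ j i l
    have h2' : φ (b i) (b l) * (μ i j - μ j l) = 0 := by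
      have := hC.mul_sub hμ i j l
      linear_combination -this
    simp only [skewDeriv_g_mul, map_sub, map_smul]
    generalize skewDeriv hμ hC i t = p at *
    generalize skewDeriv hμ hC j t = q at *
    have key : (φ (b j) (b l) * (1 - μ i j * μ i l)) • p
        + (φ (b i) (b l) * (μ i j - μ j l)) • q
        + (μ j l * μ i l) • (SCl.g b μ 0 (b l) * (skewDeriv hμ hC i q
        + μ i j • skewDeriv hμ hC j p)) = 0 := by
      rw [h1, h2', ht]; simp
    rw [← key, mul_add, mul_smul_comm]
    module

/-- The operators on the quantum exterior algebra through which the skew Clifford algebra acts. -/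
noncomputable def cliffOp (hμ : IsMulAntisymm μ) (hC : IsCompatible b μ φ) (i : ι) :
    Module.End k (QExt b μ) :=
  LinearMap.mulLeft k (SCl.g b μ 0 (b i)) + skewDeriv hμ hC i

/-- The multiplications satisfy the relations of Λ_μ and so do the derivations. The mixed terms
cancel since μ_ij μ_ji = 1, except for the scalar φ(x_i, x_j) + μ_ij φ(x_j, x_i), which is 2φ(x_i,
x_j) by μ-symmetry. -/
theorem cliffOp_mul (hμ : IsMulAntisymm μ) (hφ : IsMuSymm b μ φ) (hC : IsCompatible b μ φ)
    (i j : ι) : cliffOp hμ hC i * cliffOp hμ hC j + μ i j • (cliffOp hμ hC j * cliffOp hμ hC i)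
      = algebraMap k _ (2 * φ (b i) (b j)) := by
  refine LinearMap.ext fun w => ?_
  have h1 := skewDeriv_comm hμ hC i j w
  have h2 : SCl.g b μ 0 (b i) * (SCl.g b μ 0 (b j) * w)
      + μ i j • (SCl.g b μ 0 (b j) * (SCl.g b μ 0 (b i) * w)) = 0 := by
    rw [← mul_assoc, ← mul_assoc, ← smul_mul_assoc, ← add_mul, QExt.g_mul_g, zero_mul]
  have h3 : μ i j * φ (b j) (b i) = φ (b i) (b j) := (hφ i j).symm
  have h4 : (1 - μ i j * μ j i) • (SCl.g b μ 0 (b i) * skewDeriv hμ hC j w) = 0 := by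
    rw [(hμ i j).1, sub_self, zero_smul]
  simp only [cliffOp, LinearMap.add_apply, Module.End.mul_apply, LinearMap.smul_apply,
    LinearMap.mulLeft_apply, skewDeriv_g_mul, mul_add, Module.algebraMap_end_apply]
  generalize SCl.g b μ 0 (b i) * (SCl.g b μ 0 (b j) * w) = A at *
  generalize SCl.g b μ 0 (b j) * (SCl.g b μ 0 (b i) * w) = B at *
  calc _ = (A + μ i j • B) + (skewDeriv hμ hC i (skewDeriv hμ hC j w)
        + μ i j • skewDeriv hμ hC j (skewDeriv hμ hC i w))
        + (1 - μ i j * μ j i) • (SCl.g b μ 0 (b i) * skewDeriv hμ hC j w)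
        + (φ (b i) (b j) + μ i j * φ (b j) (b i)) • w := by module
    _ = _ := by rw [h1, h2, h3, h4]; module

/-- The action of the tensor algebra on the quantum exterior algebra through `cliffOp`. -/
noncomputable def cliffAction (hμ : IsMulAntisymm μ) (hC : IsCompatible b μ φ) :
    TensorAlgebra k V →ₐ[k] Module.End k (QExt b μ) :=
  TensorAlgebra.lift k (b.constr k (cliffOp hμ hC))

theorem cliffAction_eq_zero (hμ : IsMulAntisymm μ) (hφ : IsMuSymm b μ φ)
    (hC : IsCompatible b μ φ) {t : TensorAlgebra k V} (ht : t ∈ idealGen (rels b μ φ)) :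
    cliffAction hμ hC t = 0 := by
  refine eq_zero_of_mem_idealGen _ (map_rel b μ φ _ fun i j => ?_) ht
  simp only [cliffAction, TensorAlgebra.lift_ι_apply, Module.Basis.constr_basis]
  exact cliffOp_mul hμ hφ hC i j

/-- The skew derivations respect the filtration of the quantum exterior algebra. -/
theorem skewDeriv_mem_F (hμ : IsMulAntisymm μ) (hC : IsCompatible b μ φ) (i : ι) {n : ℕ}
    {w : QExt b μ} (hw : w ∈ (quotFil (rels b μ 0)).F n) :
    skewDeriv hμ hC i w ∈ (quotFil (rels b μ 0)).F n := by
  obtain ⟨t, ht, rfl⟩ := hw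
  have hle : tFil k V n ≤ ((quotFil (rels b μ 0)).F n).comap
      ((skewDeriv hμ hC i).comp (TQuot.mk (rels b μ 0)).toLinearMap) := by
    refine iSup₂_le fun m hm t ht => ?_
    refine (quotFil (rels b μ 0)).mono hm ?_
    clear hm
    induction ht using Submodule.pow_induction_on_left' with
    | algebraMap r =>
      simp [Algebra.algebraMap_eq_smul_one, skewDeriv_one]
    | add x y m hx hy ihx ihy =>
      rw [map_add]; exact add_mem ihx ihy
    | mem_mul v hv m x hx ih =>
      obtain ⟨v, rfl⟩ := hv
      -- The claim is linear in `v`, so it suffices to treat basis vectors, for which the Leibniz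
      -- rule is available.
      have hv : (⊤ : Submodule k V) ≤ ((quotFil (rels b μ 0)).F m.succ).comap
          (((skewDeriv hμ hC i).comp (TQuot.mk (rels b μ 0)).toLinearMap).comp
            ((LinearMap.mulRight k x).comp (TensorAlgebra.ι k))) := by
        rw [← b.span_eq, Submodule.span_le]
        rintro _ ⟨j, rfl⟩
        have h1 : TQuot.mk (rels b μ 0) x ∈ (quotFil (rels b μ 0)).F m :=
          mk_mem_quotFil _ (tPow_le_tFil le_rfl hx)
        have hg : SCl.g b μ 0 (b j) ∈ (quotFil (rels b μ 0)).F 1 :=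
          mk_mem_quotFil _ (tPow_le_tFil le_rfl (mem_tPow_one _))
        change skewDeriv hμ hC i (TQuot.mk (rels b μ 0) (TensorAlgebra.ι k (b j) * x)) ∈
          (quotFil (rels b μ 0)).F (m + 1)
        rw [map_mul]
        change skewDeriv hμ hC i (SCl.g b μ 0 (b j) * TQuot.mk (rels b μ 0) x) ∈ _
        rw [skewDeriv_g_mul]
        refine sub_mem (Submodule.smul_mem _ _ ((quotFil (rels b μ 0)).mono (Nat.le_succ m) h1))
          (Submodule.smul_mem _ _ ?_)
        rw [add_comm m 1]
        exact (quotFil (rels b μ 0)).mul_mem hg ih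
      exact hv (Submodule.mem_top (x := v))
  exact hle ht

theorem AlgFiltration.prev_le {R : Type*} [Ring R] [Algebra k R] (𝓕 : AlgFiltration k R) (n : ℕ) :
    𝓕.prev n ≤ 𝓕.F n := by
  cases n with
  | zero => exact bot_le
  | succ n => exact 𝓕.mono (Nat.le_succ n)

/-- The action on `1` of a homogeneous tensor has that tensor as its leading term. -/
theorem cliffAction_one_sub_mem (hμ : IsMulAntisymm μ) (hC : IsCompatible b μ φ) {n : ℕ}
    {t : TensorAlgebra k V} (ht : t ∈ tPow k V n) :
    cliffAction hμ hC t 1 - TQuot.mk (rels b μ 0) t ∈ (quotFil (rels b μ 0)).prev n := by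
  induction ht using Submodule.pow_induction_on_left' with
  | algebraMap r =>
    simp [Algebra.algebraMap_eq_smul_one]
  | add x y m hx hy ihx ihy =>
    rw [map_add, map_add, LinearMap.add_apply, add_sub_add_comm]; exact add_mem ihx ihy
  | mem_mul v hv m x hx ih =>
    obtain ⟨v, rfl⟩ := hv
    have hv : (⊤ : Submodule k V) ≤ ((quotFil (rels b μ 0)).F m).comap
        ((((LinearMap.applyₗ (1 : QExt b μ)).comp (cliffAction hμ hC).toLinearMap)
          - (TQuot.mk (rels b μ 0)).toLinearMap).comp
          ((LinearMap.mulRight k x).comp (TensorAlgebra.ι k))) := by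
      rw [← b.span_eq, Submodule.span_le]
      rintro _ ⟨j, rfl⟩
      have h1 : TQuot.mk (rels b μ 0) x ∈ (quotFil (rels b μ 0)).F m :=
        mk_mem_quotFil _ (tPow_le_tFil le_rfl hx)
      have hg : SCl.g b μ 0 (b j) ∈ (quotFil (rels b μ 0)).F 1 :=
        mk_mem_quotFil _ (tPow_le_tFil le_rfl (mem_tPow_one _))
      have h2 : cliffAction hμ hC x 1 ∈ (quotFil (rels b μ 0)).F m := by
        have := add_mem ((quotFil (rels b μ 0)).prev_le m ih) h1
        simpa using this
      change cliffAction hμ hC (TensorAlgebra.ι k (b j) * x) 1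
        - TQuot.mk (rels b μ 0) (TensorAlgebra.ι k (b j) * x) ∈ (quotFil (rels b μ 0)).F m
      have h3 : cliffAction hμ hC (TensorAlgebra.ι k (b j)) = cliffOp hμ hC j := by
        simp [cliffAction]
      -- The difference for x_j x is x_j times the difference for x, plus a skew derivative of an
      -- element of F m; both lie in F m, which is the step before F (m + 1).
      rw [map_mul, map_mul, h3, Module.End.mul_apply, cliffOp, LinearMap.add_apply,
        LinearMap.mulLeft_apply, TQuot.mk_ι, add_sub_right_comm, ← mul_sub]
      refine add_mem ?_ (skewDeriv_mem_F hμ hC j h2)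
      have h4 := (quotFil (rels b μ 0)).mul_prev_mem hg ih
      rwa [add_comm 1 m] at h4
    exact hv (Submodule.mem_top (x := v))

theorem cliffAction_one_mem (hμ : IsMulAntisymm μ) (hC : IsCompatible b μ φ) {n : ℕ}
    {t : TensorAlgebra k V} (ht : t ∈ tFil k V n) :
    cliffAction hμ hC t 1 ∈ (quotFil (rels b μ 0)).F n := by
  have hle : tFil k V n ≤ ((quotFil (rels b μ 0)).F n).comap
      ((LinearMap.applyₗ (1 : QExt b μ)).comp (cliffAction hμ hC).toLinearMap) := by
    refine iSup₂_le fun m hm t ht => ?_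
    refine (quotFil (rels b μ 0)).mono hm ?_
    have h1 := (quotFil (rels b μ 0)).prev_le m (cliffAction_one_sub_mem hμ hC ht)
    have h2 : TQuot.mk (rels b μ 0) t ∈ (quotFil (rels b μ 0)).F m :=
      mk_mem_quotFil _ (tPow_le_tFil le_rfl ht)
    have := add_mem h1 h2
    simpa using this
  exact hle ht

/-! ### The grading of the quantum exterior algebra -/

open Polynomial in
/-- The algebra map `T(V) → Λ_μ(V)[X]` which records the degree of tensors. -/
noncomputable def degreeMap (b : Module.Basis ι k V) (μ : Matrix ι ι k) :
    TensorAlgebra k V →ₐ[k] (QExt b μ)[X] :=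
  TensorAlgebra.lift k (b.constr k fun i => monomial 1 (SCl.g b μ 0 (b i)))

theorem degreeMap_ι (b : Module.Basis ι k V) (μ : Matrix ι ι k) (v : V) :
    degreeMap b μ (TensorAlgebra.ι k v) = Polynomial.monomial 1 (SCl.g b μ 0 v) := by
  have : b.constr k (fun i => Polynomial.monomial 1 (SCl.g b μ 0 (b i)))
      = ((Polynomial.monomial 1).restrictScalars k).comp (SCl.g b μ 0) :=
    b.ext fun i => by simp
  rw [degreeMap, TensorAlgebra.lift_ι_apply, this]
  rfl

theorem degreeMap_of_mem (b : Module.Basis ι k V) (μ : Matrix ι ι k) {n : ℕ}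
    {t : TensorAlgebra k V} (ht : t ∈ tPow k V n) :
    degreeMap b μ t = Polynomial.monomial n (TQuot.mk (rels b μ 0) t) := by
  induction ht using Submodule.pow_induction_on_left' with
  | algebraMap r => rw [AlgHom.commutes, AlgHom.commutes]; rfl
  | add x y m hx hy ihx ihy => rw [map_add, map_add, map_add, ihx, ihy]
  | mem_mul v hv m x hx ih =>
    obtain ⟨v, rfl⟩ := hv
    rw [map_mul, map_mul, ih, degreeMap_ι, Polynomial.monomial_mul_monomial, TQuot.mk_ι,
      add_comm 1 m]

/-- The relations of Λ_μ are homogeneous of degree two, so recording degrees is compatible with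
them. -/
theorem degreeMap_eq_zero {t : TensorAlgebra k V} (ht : t ∈ idealGen (rels b μ 0)) :
    degreeMap b μ t = 0 := by
  refine eq_zero_of_mem_idealGen _ (map_rel b μ 0 _ fun i j => ?_) ht
  rw [degreeMap_ι, degreeMap_ι, Polynomial.monomial_mul_monomial,
    Polynomial.monomial_mul_monomial, Polynomial.smul_monomial, ← map_add, QExt.g_mul_g]
  simp

theorem coeff_degreeMap_of_mem_tFil (b : Module.Basis ι k V) (μ : Matrix ι ι k) {m n : ℕ}
    (h : m < n) {t : TensorAlgebra k V} (ht : t ∈ tFil k V m) :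
    (degreeMap b μ t).coeff n = 0 := by
  have hle : tFil k V m ≤ LinearMap.ker
      (((Polynomial.lcoeff (QExt b μ) n).restrictScalars k).comp
        (degreeMap b μ).toLinearMap) := by
    refine iSup₂_le fun j hj t ht => ?_
    change (degreeMap b μ t).coeff n = 0
    rw [degreeMap_of_mem b μ ht, Polynomial.coeff_monomial, if_neg (by omega)]
  exact hle ht

/-- Λ_μ is itself graded: if a tensor of degree n agrees in Λ_μ with one of smaller degree,
comparing coefficients of Xⁿ under `degreeMap` shows that its class is zero. -/
theorem mk_eq_zero_of_mem_prev {n : ℕ} {t : TensorAlgebra k V} (ht : t ∈ tPow k V n)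
    (h : TQuot.mk (rels b μ 0) t ∈ (quotFil (rels b μ 0)).prev n) :
    TQuot.mk (rels b μ 0) t = 0 := by
  cases n with
  | zero => simpa [AlgFiltration.prev] using h
  | succ n =>
    obtain ⟨s, hs, hst⟩ := h
    have h1 : degreeMap b μ (s - t) = 0 := by
      refine degreeMap_eq_zero (TQuot.mk_eq_zero_iff.1 ?_)
      rw [map_sub, sub_eq_zero]
      exact hst
    have h2 : (degreeMap b μ t).coeff (n + 1) = 0 := by
      rw [map_sub, sub_eq_zero] at h1
      rw [← h1]
      exact coeff_degreeMap_of_mem_tFil b μ (Nat.lt_succ_self n) hs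
    rwa [degreeMap_of_mem b μ ht, Polynomial.coeff_monomial, if_pos rfl] at h2

/-! ### The PBW property -/

/-- A symbol of degree n depends only on the degree n component of a lift. Hence only injectivity is
at stake in the PBW property. -/
theorem toGr_surjective (S : Set (TensorAlgebra k V)) : Function.Surjective (toGr S) := by
  intro x
  induction x using DirectSum.induction_on with
  | zero => exact ⟨0, map_zero _⟩
  | add x y hx hy =>
    obtain ⟨s, rfl⟩ := hx
    obtain ⟨t, rfl⟩ := hy
    exact ⟨s + t, map_add _ _ _⟩
  | of n x =>
    obtain ⟨⟨_, t, ht, rfl⟩, rfl⟩ := (quotFil S).symb_surjective n x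
    refine ⟨GradedAlgebra.proj (tPow k V) n t, ?_⟩
    rw [toGr_of_mem S (proj_mem_tPow n t)]
    congr 1
    rw [← sub_eq_zero, ← map_sub, AlgFiltration.symb_eq_zero]
    change TQuot.mk S (GradedAlgebra.proj (tPow k V) n t) - TQuot.mk S t ∈ _
    rw [← map_sub, ← neg_mem_iff, ← map_neg, neg_sub]
    -- In degree zero the previous step is ⊥, so the two classes must be equal and not merely close.
    cases n with
    | zero =>
      have : t ∈ tPow k V 0 := by
        have h2 : tFil k V 0 ≤ tPow k V 0 := iSup₂_le fun j hj => by
          obtain rfl : j = 0 := by omega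
          exact le_rfl
        exact h2 ht
      rw [proj_of_mem this, sub_self, map_zero]
      exact zero_mem _
    | succ n => exact mk_mem_quotFil S (sub_proj_mem_tFil ht)

/-- The kernel of `toGr` is detected one degree at a time, which reduces injectivity to homogeneous
tensors. -/
theorem mk_proj_mem_prev {S : Set (TensorAlgebra k V)} {t : TensorAlgebra k V}
    (h : toGr S t = 0) (n : ℕ) :
    TQuot.mk S (GradedAlgebra.proj (tPow k V) n t) ∈ (quotFil S).prev n := by
  classical
  have key : ∀ u : TensorAlgebra k V, toGr S u n = (quotFil S).symb n
      ⟨TQuot.mk S (GradedAlgebra.proj (tPow k V) n u),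
        mk_mem_quotFil S (tPow_le_tFil le_rfl (proj_mem_tPow n u))⟩ := by
    intro u
    -- Both sides are linear in `u`, so it is enough to compare them on homogeneous components.
    obtain ⟨s, hs⟩ := sum_proj u
    let f : TensorAlgebra k V →ₗ[k] (quotFil S).GrPart n :=
      ((quotFil S).symb n).comp (((TQuot.mk S).toLinearMap.comp
        (GradedAlgebra.proj (tPow k V) n)).codRestrict _ fun u =>
          mk_mem_quotFil S (tPow_le_tFil le_rfl (proj_mem_tPow n u)))
    let g : TensorAlgebra k V →ₗ[k] (quotFil S).GrPart n :=
      (DirectSum.component k ℕ _ n).comp (toGr S).toLinearMap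
    change g u = f u
    rw [← hs, map_sum, map_sum]
    refine Finset.sum_congr rfl fun m _ => ?_
    generalize hw : GradedAlgebra.proj (tPow k V) m u = w
    have hwm : w ∈ tPow k V m := hw ▸ proj_mem_tPow m u
    change toGr S w n = _
    rw [toGr_of_mem S hwm]
    by_cases hmn : m = n
    · subst hmn
      rw [DirectSum.of_eq_same]
      change _ = (quotFil S).symb m ⟨TQuot.mk S (GradedAlgebra.proj (tPow k V) m w), _⟩
      congr 2
      rw [proj_of_mem hwm]
    · rw [DirectSum.of_eq_of_ne _ _ _ (Ne.symm hmn)]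
      symm
      refine (quotFil S).symb_eq_zero.2 ?_
      change TQuot.mk S (GradedAlgebra.proj (tPow k V) n w) ∈ _
      rw [proj_of_mem_ne hmn hwm, map_zero]
      exact zero_mem _
  have := key t
  rw [h] at this
  exact (quotFil S).symb_eq_zero.1 this.symm

/-- Suppose a tensor u of degree n equals in sCl a tensor w of smaller degree. Then u and w act
alike on 1 ∈ Λ_μ. The action of u has leading term u, while that of w stays below degree n, so u
vanishes in Λ_μ. -/
theorem isPBWDeformation_of_isCompatible (hμ : IsMulAntisymm μ) (hφ : IsMuSymm b μ φ)
    (hC : IsCompatible b μ φ) : IsPBWDeformation b μ (Submodule.span k (rels b μ φ)) := by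
  refine ⟨isDeformation_span_rels b μ φ, ?_, ?_⟩
  · rw [injective_iff_map_eq_zero]
    intro x hx
    obtain ⟨t, rfl⟩ := TQuot.mk_surjective _ x
    replace hx : toGr (Submodule.span k (rels b μ φ) : Set (TensorAlgebra k V)) t = 0 := hx
    obtain ⟨s, hs⟩ := sum_proj t
    rw [← hs, map_sum]
    refine Finset.sum_eq_zero fun n _ => ?_
    have h1 := mk_proj_mem_prev hx n
    have h2 := proj_mem_tPow n t
    generalize GradedAlgebra.proj (tPow k V) n t = u at *
    refine mk_eq_zero_of_mem_prev h2 ?_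
    have h3 := cliffAction_one_sub_mem hμ hC h2
    suffices h4 : cliffAction hμ hC u 1 ∈ (quotFil (rels b μ 0)).prev n by
      have := sub_mem h4 h3
      simpa using this
    have hker : ∀ w : TensorAlgebra k V,
        TQuot.mk (Submodule.span k (rels b μ φ) : Set (TensorAlgebra k V)) w = 0 →
        cliffAction hμ hC w = 0 := fun w hw => by
      rw [TQuot.mk_eq_zero_iff, idealGen_span] at hw
      exact cliffAction_eq_zero hμ hφ hC hw
    cases n with
    | zero =>
      rw [hker u (by simpa [AlgFiltration.prev] using h1)]
      exact zero_mem _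
    | succ n =>
      obtain ⟨w, hw, hwu⟩ := h1
      have h5 : cliffAction hμ hC (w - u) = 0 :=
        hker _ (by rw [map_sub, sub_eq_zero]; exact hwu)
      rw [map_sub, sub_eq_zero] at h5
      rw [← h5]
      exact cliffAction_one_mem hμ hC hw
  · intro x
    obtain ⟨t, rfl⟩ := toGr_surjective _ x
    exact ⟨TQuot.mk _ t, rfl⟩

end PBW

/-! ### Recovering the bilinear form from a ℤ/2-graded PBW deformation. -/

section GradedDeformation

variable {k V ι : Type*} [Field k] [AddCommGroup V] [Module k V]
variable {b : Module.Basis ι k V} {μ : Matrix ι ι k} {P : Submodule k (TensorAlgebra k V)}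

open DualNumber in
/-- The relations of the quantum exterior algebra imply no relations in degrees at most one. -/
theorem eq_zero_of_mem_idealGen_rels_zero (b : Module.Basis ι k V) (μ : Matrix ι ι k) {c : k}
    {v : V} (h : algebraMap k _ c + TensorAlgebra.ι k v ∈ idealGen (rels b μ 0)) :
    c = 0 ∧ v = 0 := by
  have key : ∀ f : V →ₗ[k] k, c = 0 ∧ f v = 0 := by
    intro f
    -- Sending v to f(v) ε kills all products of two vectors since ε² = 0, hence all relations, but
    -- keeps c and f(v).
    let F : TensorAlgebra k V →ₐ[k] k[ε] :=
      TensorAlgebra.lift k ((LinearMap.toSpanSingleton k k[ε] ε).comp f)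
    have hF : F (algebraMap k _ c + TensorAlgebra.ι k v) = 0 := by
      refine eq_zero_of_mem_idealGen F (map_rel b μ 0 F fun i j => ?_) h
      simp [F]
    have hF' : algebraMap k k[ε] c + f v • (ε : k[ε]) = 0 := by simpa [F] using hF
    refine ⟨?_, ?_⟩
    · simpa [TrivSqZeroExt.algebraMap_eq_inl] using congrArg TrivSqZeroExt.fst hF'
    · simpa [TrivSqZeroExt.algebraMap_eq_inl] using congrArg TrivSqZeroExt.snd hF'
  refine ⟨(key 0).1, ?_⟩
  rw [← b.forall_coord_eq_zero_iff]
  exact fun i => (key (b.coord i)).2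

theorem IsDeformation.mem_idealGen_of_toGr_eq_zero (h : IsDeformation b μ P)
    (hinj : Function.Injective h.toGr) {t : TensorAlgebra k V}
    (ht : SkewClifford.toGr (P : Set (TensorAlgebra k V)) t = 0) : t ∈ idealGen (rels b μ 0) := by
  rw [← TQuot.mk_eq_zero_iff]
  exact hinj (ht.trans (map_zero _).symm)

/-- A PBW deformation satisfies no relations in degrees at most one. -/
theorem IsDeformation.eq_zero_of_mk_eq_zero (h : IsDeformation b μ P)
    (hinj : Function.Injective h.toGr) {t : TensorAlgebra k V} (ht : t ∈ tFil k V 1)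
    (h0 : TQuot.mk (P : Set (TensorAlgebra k V)) t = 0) : t = 0 := by
  obtain ⟨c, v, rfl⟩ := mem_tFil_one ht
  have hv : v = 0 := by
    -- In the quotient v equals the scalar -c, which lies in F 0, so the symbol of v in degree one
    -- is zero.
    have h1 : SkewClifford.toGr (P : Set (TensorAlgebra k V)) (TensorAlgebra.ι k v) = 0 := by
      rw [toGr_of_mem _ (mem_tPow_one v)]
      refine (congrArg (DirectSum.of _ 1) ((AlgFiltration.symb_eq_zero _).2 ?_)).trans (map_zero _)
      rw [map_add, add_comm] at h0
      change TQuot.mk (P : Set (TensorAlgebra k V)) (TensorAlgebra.ι k v) ∈ (quotFil _).F 0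
      rw [eq_neg_of_add_eq_zero_left h0]
      exact neg_mem (mk_mem_quotFil _ (tPow_le_tFil le_rfl (algebraMap_mem_tPow c)))
    have h2 := h.mem_idealGen_of_toGr_eq_zero hinj h1
    refine (eq_zero_of_mem_idealGen_rels_zero b μ (c := 0) (v := v) ?_).2
    simpa using h2
  subst hv
  rw [map_zero, add_zero] at h0 ⊢
  have h1 : SkewClifford.toGr (P : Set (TensorAlgebra k V)) (algebraMap k _ c) = 0 := by
    rw [toGr_of_mem _ (algebraMap_mem_tPow c)]
    refine (congrArg (DirectSum.of _ 0) ((AlgFiltration.symb_eq_zero _).2 ?_)).trans (map_zero _)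
    change TQuot.mk (P : Set (TensorAlgebra k V)) (algebraMap k _ c) ∈ _
    rw [h0]
    exact zero_mem _
  have h2 := h.mem_idealGen_of_toGr_eq_zero hinj h1
  have h3 := (eq_zero_of_mem_idealGen_rels_zero b μ (c := c) (v := 0) (by simpa using h2)).1
  rw [h3, map_zero]

/-- The relations of a `ℤ/2`-graded PBW deformation have no linear part. -/
theorem IsDeformation.exists_sub_algebraMap_mem (h : IsDeformation b μ P)
    (hinj : Function.Injective h.toGr) (hgr : IsZ2Graded P) (i j : ι) :
    ∃ c : k, rel b μ 0 i j - algebraMap k _ c ∈ P := by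
  have hq : rel b μ 0 i j ∈ P.map proj₂ := h.proj ▸ Submodule.subset_span ⟨i, j, rfl⟩
  obtain ⟨p, hp, hpq⟩ := hq
  obtain ⟨c, v, hcv⟩ := mem_tFil_one (sub_proj_mem_tFil (h.le hp))
  change p - proj₂ p = _ at hcv
  rw [hpq, sub_eq_iff_eq_add] at hcv
  have hv : v = 0 := by
    obtain ⟨𝒜, ⟨hA⟩, hodd⟩ := hgr
    have hp0 := TQuot.mk_eq_zero_of_mem (S := (P : Set (TensorAlgebra k V))) hp
    have h1 : rel b μ 0 i j = TensorAlgebra.ι k (b i) * TensorAlgebra.ι k (b j)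
      + μ i j • (TensorAlgebra.ι k (b j) * TensorAlgebra.ι k (b i)) := by simp [rel]
    have hmul : ∀ u w : V, TQuot.gen (P : Set (TensorAlgebra k V)) u * TQuot.gen _ w ∈ 𝒜 0 :=
      fun u w => SetLike.mul_mem_graded (hodd u) (hodd w)
    -- The relation `p` expresses v through a scalar and products of two odd elements, so v is even
    -- as well as odd.
    have heven : TQuot.gen (P : Set (TensorAlgebra k V)) v ∈ 𝒜 0 := by
      have h2 : TQuot.gen (P : Set (TensorAlgebra k V)) v =
          -(algebraMap k _ c + (TQuot.gen _ (b i) * TQuot.gen _ (b j)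
            + μ i j • (TQuot.gen _ (b j) * TQuot.gen _ (b i)))) := by
        rw [hcv, h1, map_add, map_add, map_add, map_smul, map_mul, map_mul, AlgHom.commutes] at hp0
        rw [eq_neg_iff_add_eq_zero, ← hp0]
        simp only [TQuot.mk_ι]
        abel
      rw [h2]
      refine neg_mem (add_mem (SetLike.algebraMap_mem_graded 𝒜 c)
        (add_mem (hmul _ _) (Submodule.smul_mem _ _ (hmul _ _))))
    have hz : TQuot.gen (P : Set (TensorAlgebra k V)) v = 0 := by
      rw [← DirectSum.decompose_of_mem_same 𝒜 heven,
        DirectSum.decompose_of_mem_ne 𝒜 (hodd v) (by decide)]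
    have h3 := h.eq_zero_of_mk_eq_zero hinj (tPow_le_tFil le_rfl (mem_tPow_one v)) hz
    exact (TensorAlgebra.ι_eq_zero_iff k v).1 h3
  refine ⟨-c, ?_⟩
  rw [hv, map_zero, add_zero] at hcv
  rw [map_neg, sub_neg_eq_add, add_comm, ← hcv]
  exact hp

/-- Everything follows from P ∩ F¹T = 0: elements of `P` are determined by their quadratic parts. -/
theorem IsDeformation.exists_eq_span_rels (hchar : (2 : k) ≠ 0) (hμ : IsMulAntisymm μ)
    (h : IsDeformation b μ P) (hinj : Function.Injective h.toGr) (hgr : IsZ2Graded P) :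
    ∃ φ : LinearMap.BilinForm k V, IsMuSymm b μ φ ∧ P = Submodule.span k (rels b μ φ) := by
  choose c hc using h.exists_sub_algebraMap_mem hinj hgr
  have hlow : ∀ t ∈ P, t ∈ tFil k V 1 → t = 0 := fun t ht ht1 =>
    h.eq_zero_of_mk_eq_zero hinj ht1 (TQuot.mk_eq_zero_of_mem ht)
  let φ : LinearMap.BilinForm k V := b.constr k fun i => b.constr k fun j => c i j / 2
  have hφ : ∀ i j, 2 * φ (b i) (b j) = c i j := fun i j => by
    simp only [φ, Module.Basis.constr_basis]
    field_simp
  have hrel : ∀ i j, rel b μ φ i j ∈ P := fun i j => by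
    rw [rel_eq, hφ]
    exact hc i j
  refine ⟨φ, fun i j => ?_, le_antisymm ?_ ?_⟩
  -- The quadratic parts cancel because μ_ij μ_ji = 1; the remaining scalar lies in `P`, so it is
  -- zero, and this is μ-symmetry.
  · have h1 : rel b μ φ i j - μ i j • rel b μ φ j i
        = algebraMap k _ (μ i j * (2 * φ (b j) (b i)) - 2 * φ (b i) (b j)) := by
      have h2 := (hμ i j).1
      simp only [rel, smul_sub, smul_add, smul_smul, h2, Algebra.algebraMap_eq_smul_one]
      module
    have h2 := hlow _ (sub_mem (hrel i j) (Submodule.smul_mem _ (μ i j) (hrel j i)))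
      (h1 ▸ tPow_le_tFil (by norm_num) (algebraMap_mem_tPow _))
    rw [h1, map_eq_zero_iff _ (TensorAlgebra.algebraMap_leftInverse V).injective] at h2
    apply mul_left_cancel₀ hchar
    linear_combination -h2
  · intro p hp
    -- Some `p'` in the span of the relations has the same quadratic part as `p`; the difference
    -- lies in P ∩ F¹T.
    have h1 : proj₂ p ∈ Submodule.span k (rels b μ 0) := h.proj ▸ ⟨p, hp, rfl⟩
    rw [← (isDeformation_span_rels b μ φ).proj] at h1
    obtain ⟨p', hp', hpp⟩ := h1
    have hle : Submodule.span k (rels b μ φ) ≤ P := by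
      rw [Submodule.span_le]
      rintro _ ⟨i, j, rfl⟩
      exact hrel i j
    have h2 : p - p' ∈ P := sub_mem hp (hle hp')
    have h3 := sub_proj_mem_tFil (h.le h2)
    change p - p' - proj₂ (p - p') ∈ _ at h3
    rw [map_sub, hpp, sub_self, sub_zero] at h3
    rw [sub_eq_zero.1 (hlow _ h2 h3)]
    exact hp'
  · rw [Submodule.span_le]
    rintro _ ⟨i, j, rfl⟩
    exact hrel i j

theorem IsDeformation.nontrivial (h : IsDeformation b μ P) (hinj : Function.Injective h.toGr) :
    Nontrivial (TQuot (P : Set (TensorAlgebra k V))) := by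
  refine nontrivial_of_ne 1 0 fun h1 => ?_
  have h2 := h.eq_zero_of_mk_eq_zero hinj (t := 1)
    (tPow_le_tFil (Nat.zero_le 1) (by simp)) ((map_one _).trans h1)
  exact one_ne_zero h2

end GradedDeformation

/-! ### Elements satisfying the relations of a skew Clifford algebra -/

section Overlaps

variable {k A ι : Type*} [Field k] [Ring A] [Algebra k A]

/-- The diamond lemma overlap: xyz is rewritten towards zyx starting from xy or from yz. Both ways
end in -prs · zyx, and the identity is the difference of the linear remainders. -/
theorem overlap_eq_zero {x y z : A} {a c d p r s : k}
    (hxy : x * y + p • (y * x) = algebraMap k A (2 * a))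
    (hxz : x * z + r • (z * x) = algebraMap k A (2 * c))
    (hyz : y * z + s • (z * y) = algebraMap k A (2 * d)) :
    (2 * (d * (p * r - 1))) • x - (2 * (c * (p - s))) • y + (2 * (a * (1 - s * r))) • z = 0 := by
  rw [Algebra.algebraMap_eq_smul_one, ← eq_sub_iff_add_eq] at hxy hxz hyz
  have e1 : x * y * z = (2 * a) • z - p • (y * (x * z)) := by
    rw [hxy, sub_mul, smul_mul_assoc, smul_mul_assoc, one_mul, mul_assoc]
  have e2 : y * (x * z) = (2 * c) • y - r • (y * z * x) := by
    rw [hxz, mul_sub, mul_smul_comm, mul_smul_comm, mul_one, mul_assoc]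
  have e3 : y * z * x = (2 * d) • x - s • (z * (y * x)) := by
    rw [hyz, sub_mul, smul_mul_assoc, smul_mul_assoc, one_mul, mul_assoc]
  have e4 : x * y * z = (2 * d) • x - s • (x * z * y) := by
    rw [mul_assoc, hyz, mul_sub, mul_smul_comm, mul_smul_comm, mul_one, mul_assoc]
  have e5 : x * z * y = (2 * c) • y - r • (z * (x * y)) := by
    rw [hxz, sub_mul, smul_mul_assoc, smul_mul_assoc, one_mul, mul_assoc]
  have e6 : z * (x * y) = (2 * a) • z - p • (z * (y * x)) := by
    rw [hxy, mul_sub, mul_smul_comm, mul_smul_comm, mul_one]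
  -- The two copies of xyz are expanded along the two different routes.
  have e7 : x * y * z - x * y * z = 0 := sub_self _
  nth_rewrite 2 [e4] at e7
  rw [e1, e2, e3, e5, e6] at e7
  rw [← e7]
  module

theorem exists_eq_smul_of_smul_eq {x y : A} {c d : k} (hc : c ≠ 0) (h : c • x = d • y) :
    ∃ γ : k, x = γ • y :=
  ⟨c⁻¹ * d, by rw [mul_smul, ← h, inv_smul_smul₀ hc]⟩

variable {μ : Matrix ι ι k} {q : ι → ι → k} {x : ι → A}

theorem sq_eq_smul_one (hchar : (2 : k) ≠ 0) (hμ : IsMulAntisymm μ)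
    (hx : ∀ i j, x i * x j + μ i j • (x j * x i) = algebraMap k A (2 * q i j)) (i : ι) :
    x i * x i = q i i • (1 : A) := by
  have h := hx i i
  rw [(hμ i i).2, one_smul, ← two_smul k, Algebra.algebraMap_eq_smul_one, mul_smul] at h
  exact smul_right_injective A hchar h

/-- The overlap x_i x_i x_l reads 4 q_il (μ_il - 1) x_i + 2 q_ii (1 - μ_il²) x_l = 0, and
non-proportionality makes both coefficients vanish. -/
theorem mu_conditions (hchar : (2 : k) ≠ 0) (hμ : IsMulAntisymm μ)
    (hx : ∀ i j, x i * x j + μ i j • (x j * x i) = algebraMap k A (2 * q i j)) {i l : ι}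
    (hl : x l ≠ 0) (hil : ∀ γ : k, x i ≠ γ • x l) :
    (q i l ≠ 0 → μ i l = 1) ∧ (q i i ≠ 0 → μ i l * μ i l = 1) := by
  have h := overlap_eq_zero (hx i i) (hx i l) (hx i l)
  rw [(hμ i i).2, one_mul] at h
  have h1 : q i l * (μ i l - 1) = 0 := by
    by_contra hne
    have h2 : (2 * 2 * (q i l * (μ i l - 1))) • x i
        = -(2 * (q i i * (1 - μ i l * μ i l))) • x l := by
      rw [← sub_eq_zero, ← h]
      module
    obtain ⟨γ, hγ⟩ := exists_eq_smul_of_smul_eq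
      (mul_ne_zero (mul_ne_zero hchar hchar) hne) h2
    exact hil γ hγ
  have h2 : (2 * (q i i * (1 - μ i l * μ i l))) • x l = 0 := by
    have h3 : (2 * 2 * (q i l * (μ i l - 1))) • x i = 0 := by rw [h1, mul_zero, zero_smul]
    linear_combination (norm := module) h - h3
  have h3 := (mul_eq_zero.1 ((smul_eq_zero.1 h2).resolve_right hl)).resolve_left hchar
  refine ⟨fun hne => sub_eq_zero.1 ((mul_eq_zero.1 h1).resolve_left hne), fun hne => ?_⟩
  exact (sub_eq_zero.1 ((mul_eq_zero.1 h3).resolve_left hne)).symm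

/-- Overlaps between pairwise non-proportional elements resolve. -/
theorem mul_eq_one_of_ne_smul (hchar : (2 : k) ≠ 0) (hμ : IsMulAntisymm μ)
    (hx : ∀ i j, x i * x j + μ i j • (x j * x i) = algebraMap k A (2 * q i j))
    {s : Set ι} (hs0 : ∀ i ∈ s, x i ≠ 0)
    (hs : ∀ i ∈ s, ∀ j ∈ s, i ≠ j → ∀ γ : k, x i ≠ γ • x j) {i j l : ι}
    (hi : i ∈ s) (hj : j ∈ s) (hl : l ∈ s) (hq : q j l ≠ 0) : μ i j * μ i l = 1 := by
  have hM : ∀ {i l : ι}, i ∈ s → l ∈ s → q i l ≠ 0 → μ i l = 1 := by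
    intro i l hi hl hq
    by_cases hil : i = l
    · subst hil; exact (hμ i i).2
    · exact (mu_conditions hchar hμ hx (hs0 l hl) (hs i hi l hl hil)).1 hq
  have hjl := hM hj hl hq
  have hlj : μ l j = 1 := by
    have := (hμ l j).1
    rwa [hjl, mul_one] at this
  by_cases hij : i = j
  · subst hij
    rw [(hμ i i).2, hjl, one_mul]
  by_cases hil : i = l
  · subst hil
    rw [(hμ i i).2, hlj, one_mul]
  by_cases hjl' : j = l
  · subst hjl'
    have h1 := (mu_conditions hchar hμ hx (hs0 i hi) (hs j hj i hi (Ne.symm hij))).2 hq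
    have h2 := (hμ i j).1
    linear_combination (μ i j * μ j i + 1) * h2 - (μ i j * μ i j) * h1
  have h := overlap_eq_zero (hx i j) (hx i l) (hx j l)
  rw [hjl, one_mul] at h
  -- A nonzero q_ij or q_il already forces μ_ij = 1 or μ_il = 1. In each case at most two terms of
  -- the overlap survive, so that pairwise non-proportionality suffices.
  by_cases h1 : q i j = 0 <;> by_cases h2 : q i l = 0
  · simp only [h1, h2, zero_mul, mul_zero, zero_smul, sub_zero, add_zero] at h
    have h3 := (mul_eq_zero.1 ((smul_eq_zero.1 h).resolve_right (hs0 i hi))).resolve_left hchar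
    exact sub_eq_zero.1 ((mul_eq_zero.1 h3).resolve_left hq)
  · rw [hM hi hl h2, mul_one] at h ⊢
    by_contra hne
    simp only [h1, zero_mul, mul_zero, zero_smul, add_zero, sub_eq_zero] at h
    obtain ⟨γ, hγ⟩ := exists_eq_smul_of_smul_eq
      (mul_ne_zero hchar (mul_ne_zero hq (sub_ne_zero.2 hne))) h
    exact hs i hi j hj hij γ hγ
  · rw [hM hi hj h1, one_mul] at h ⊢
    by_contra hne
    simp only [h2, zero_mul, mul_zero, zero_smul, sub_zero] at h
    obtain ⟨γ, hγ⟩ := exists_eq_smul_of_smul_eq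
      (mul_ne_zero hchar (mul_ne_zero hq (sub_ne_zero.2 hne)))
      ((eq_neg_of_add_eq_zero_left h).trans (neg_smul _ _).symm)
    exact hs i hi l hl hil γ hγ
  · rw [hM hi hj h1, hM hi hl h2, one_mul]

theorem form_eq_zero_of_eq_zero [Nontrivial A] (hchar : (2 : k) ≠ 0)
    (hx : ∀ i j, x i * x j + μ i j • (x j * x i) = algebraMap k A (2 * q i j)) {i j : ι}
    (h : x i = 0 ∨ x j = 0) : q i j = 0 := by
  have h1 := hx i j
  have h2 : algebraMap k A (2 * q i j) = 0 := by
    rw [← h1]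
    rcases h with h | h <;> simp [h]
  rw [map_eq_zero_iff _ (algebraMap k A).injective] at h2
  exact (mul_eq_zero.1 h2).resolve_left hchar

/-- An element whose products with an active generator are scalars is proportional to it. -/
theorem exists_eq_smul_of_mul_eq_smul_one [Nontrivial A] (hchar : (2 : k) ≠ 0)
    (hμ : IsMulAntisymm μ)
    (hx : ∀ i j, x i * x j + μ i j • (x j * x i) = algebraMap k A (2 * q i j)) {l j m : ι}
    (hq : q j m ≠ 0) {c c' : k} (hlj : x l * x j = c • (1 : A)) (hjl : x j * x l = c' • (1 : A)) :
    ∃ γ : k, x l = γ • x j := by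
  have hsq := sq_eq_smul_one hchar hμ hx j
  have hj : x j ≠ 0 := fun h => hq (form_eq_zero_of_eq_zero hchar hx (Or.inl h))
  -- Obtained by bracketing x_l x_j x_j in two ways; `h2` does the same on the other side.
  have h1 : q j j • x l = c • x j := by
    have : x l * (x j * x j) = x l * x j * x j := (mul_assoc _ _ _).symm
    rwa [hsq, hlj, mul_smul_comm, mul_one, smul_mul_assoc, one_mul] at this
  have h2 : q j j • x l = c' • x j := by
    have : x j * x j * x l = x j * (x j * x l) := mul_assoc _ _ _
    rwa [hsq, hjl, mul_smul_comm, mul_one, smul_mul_assoc, one_mul] at this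
  by_cases h0 : q j j = 0
  · rw [h0, zero_smul] at h1 h2
    have hc : c = 0 := (smul_eq_zero.1 h1.symm).resolve_right hj
    have hc' : c' = 0 := (smul_eq_zero.1 h2.symm).resolve_right hj
    rw [hc, zero_smul] at hlj
    rw [hc', zero_smul] at hjl
    have h3 := hx j m
    have h4 := hx l m
    rw [Algebra.algebraMap_eq_smul_one] at h3 h4
    rw [← eq_sub_iff_add_eq] at h4
    -- When x_j² = 0 the partner x_m replaces it: x_l is multiplied by the relation of x_j and x_m,
    -- where x_l x_j = 0 removes all but a multiple of x_j.
    have h5 : (2 * q j m) • x l = (μ j m * (2 * q l m)) • x j := by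
      calc (2 * q j m) • x l = x l * ((2 * q j m) • (1 : A)) := by rw [mul_smul_comm, mul_one]
        _ = x l * x j * x m + μ j m • (x l * x m * x j) := by
          rw [← h3, mul_add, mul_smul_comm, mul_assoc, mul_assoc]
        _ = _ := by
          rw [hlj, zero_mul, zero_add, h4, sub_mul, smul_mul_assoc, smul_mul_assoc, one_mul,
            mul_assoc, hlj, mul_zero, smul_zero, sub_zero, smul_smul]
    exact exists_eq_smul_of_smul_eq (mul_ne_zero hchar hq) h5
  · exact exists_eq_smul_of_smul_eq h0 h1

end Overlaps

/-! ### Discarding zero and proportional generators. -/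

section Reduction

variable {k V ι : Type*} [Field k] [AddCommGroup V] [Module k V]
variable {b : Module.Basis ι k V} {μ : Matrix ι ι k} {φ : LinearMap.BilinForm k V}

theorem subBasis_coe (b : Module.Basis ι k V) (s : Set ι) (i : s) : (subBasis b s i : V) = b i :=
  congrArg Subtype.val (Module.Basis.span_apply _ i)

/-- A generator which is orthogonal to all generators is not proportional to another one. -/
theorem SCl.g_eq_zero_of_eq_smul (hφ : IsMuSymm b μ φ) {i j : ι} (hij : i ≠ j) {α : k}
    (hα : SCl.g b μ φ (b i) = α • SCl.g b μ φ (b j)) (hj : ∀ m, φ (b j) (b m) = 0) :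
    SCl.g b μ φ (b i) = 0 := by
  classical
  -- Killing x_j and fixing the other generators respects the relations because x_j is orthogonal to
  -- everything; applied to x_i = α x_j it gives x_i = 0.
  let f : SCl b μ φ →ₐ[k] SCl b μ φ :=
    SCl.lift b μ φ (fun l => if l = j then 0 else SCl.g b μ φ (b l)) (fun l m => by
      by_cases hl : l = j
      · subst hl
        simp [hj m]
      by_cases hm : m = j
      · subst hm
        have : φ (b l) (b m) = 0 := by rw [hφ l m, hj l, mul_zero]
        simp [this]
      rw [if_neg hl, if_neg hm]
      exact SCl.g_mul_g b μ φ l m)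
  have h := congrArg f hα
  rw [map_smul, SCl.lift_g, SCl.lift_g, if_neg hij, if_pos rfl, smul_zero] at h
  exact h

/-- If the two entries differ, the relations for (i, l) and (j, m) are independent enough to make
x_m x_j and x_j x_m scalars. As i ≠ j or l ≠ m, one of x_j, x_m pairs nontrivially with some
generator, and `exists_eq_smul_of_mul_eq_smul_one` makes the two proportional. -/
theorem mu_eq_mu_of_eq_smul (hchar : (2 : k) ≠ 0) (hμ : IsMulAntisymm μ) (hφ : IsMuSymm b μ φ)
    [Nontrivial (SCl b μ φ)] {i l j m : ι} {α β : k}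
    (hi : SCl.g b μ φ (b i) = α • SCl.g b μ φ (b j))
    (hl : SCl.g b μ φ (b l) = β • SCl.g b μ φ (b m))
    (hi0 : SCl.g b μ φ (b i) ≠ 0) (hl0 : SCl.g b μ φ (b l) ≠ 0)
    (hjm : ∀ γ : k, SCl.g b μ φ (b j) ≠ γ • SCl.g b μ φ (b m))
    (hmj : ∀ γ : k, SCl.g b μ φ (b m) ≠ γ • SCl.g b μ φ (b j)) : μ i l = μ j m := by
  by_contra hne
  have hx := SCl.g_mul_g b μ φ
  have hα : α ≠ 0 := by rintro rfl; exact hi0 (by rw [hi, zero_smul])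
  have hβ : β ≠ 0 := by rintro rfl; exact hl0 (by rw [hl, zero_smul])
  have hactive : ∀ {i j : ι} {α : k}, SCl.g b μ φ (b i) = α • SCl.g b μ φ (b j) →
      SCl.g b μ φ (b i) ≠ 0 → i ≠ j → ∃ p, φ (b j) (b p) ≠ 0 := by
    intro i j α h h0 hij
    by_contra! hall
    exact h0 (SCl.g_eq_zero_of_eq_smul hφ hij h hall)
  have h1 := hx i l
  have h2 := hx j m
  rw [hi, hl, Algebra.algebraMap_eq_smul_one] at h1
  rw [Algebra.algebraMap_eq_smul_one] at h2
  simp only [smul_mul_assoc, mul_smul_comm, smul_smul] at h1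
  have h3 : (α * β * (μ i l - μ j m)) • (SCl.g b μ φ (b m) * SCl.g b μ φ (b j))
      = (2 * φ (b i) (b l) - α * β * (2 * φ (b j) (b m))) • (1 : SCl b μ φ) := by
    linear_combination (norm := module) h1 - (α * β) • h2
  obtain ⟨c, hc⟩ := exists_eq_smul_of_smul_eq
    (mul_ne_zero (mul_ne_zero hα hβ) (sub_ne_zero.2 hne)) h3
  have hc' : SCl.g b μ φ (b j) * SCl.g b μ φ (b m)
      = (2 * φ (b j) (b m) - μ j m * c) • (1 : SCl b μ φ) := by
    rw [hc] at h2
    linear_combination (norm := module) h2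
  by_cases hij : i = j
  · by_cases hlm : l = m
    · exact hne (by rw [hij, hlm])
    · obtain ⟨p, hp⟩ := hactive hl hl0 hlm
      obtain ⟨γ, hγ⟩ := exists_eq_smul_of_mul_eq_smul_one
        (q := fun i j => φ (b i) (b j)) hchar hμ hx hp hc' hc
      exact hjm γ hγ
  · obtain ⟨p, hp⟩ := hactive hi hi0 hij
    obtain ⟨γ, hγ⟩ := exists_eq_smul_of_mul_eq_smul_one
      (q := fun i j => φ (b i) (b j)) hchar hμ hx hp hc hc'
    exact hmj γ hγ

theorem exists_representatives {A : Type*} [AddCommGroup A] [Module k A] (x : ι → A) :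
    ∃ (s : Set ι) (r : ι → ι) (α : ι → k), (∀ i, x i = α i • x (r i)) ∧
      (∀ i, r i ∈ s ↔ x i ≠ 0) ∧ (∀ i ∈ s, r i = i ∧ α i = 1) ∧
      ∀ i ∈ s, ∀ j ∈ s, i ≠ j → ∀ γ : k, x i ≠ γ • x j := by
  classical
  let L : ι → Submodule k A := fun i => Submodule.span k {x i}
  -- The chosen index depends only on the line spanned by x_i, so `r` is constant on proportionality
  -- classes and idempotent.
  let r : ι → ι := fun i => haveI : Nonempty ι := ⟨i⟩; Function.invFun L (L i)
  have hL : ∀ i, L (r i) = L i := fun i => by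
    have : Nonempty ι := ⟨i⟩
    exact Function.invFun_eq ⟨i, rfl⟩
  have hr : ∀ i j, L i = L j → r i = r j := fun i j h => by
    have : Nonempty ι := ⟨i⟩
    change Function.invFun L (L i) = Function.invFun L (L j)
    rw [h]
  have hmem : ∀ i, ∃ a : k, x i = a • x (r i) := fun i => by
    have : x i ∈ L (r i) := by rw [hL]; exact Submodule.mem_span_singleton_self _
    obtain ⟨a, ha⟩ := Submodule.mem_span_singleton.1 this
    exact ⟨a, ha.symm⟩
  have hzero : ∀ i, x (r i) = 0 ↔ x i = 0 := fun i => by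
    rw [← Submodule.span_singleton_eq_bot (R := k), ← Submodule.span_singleton_eq_bot (R := k)]
    exact Eq.congr_left (hL i)
  choose a ha using hmem
  refine ⟨{i | x i ≠ 0 ∧ r i = i}, r, fun i => if r i = i then 1 else a i, fun i => ?_,
    fun i => ?_, fun i hi => ⟨hi.2, if_pos hi.2⟩, ?_⟩
  · by_cases h : r i = i
    · simp [h]
    · simp only [h, if_false]; exact ha i
  · constructor
    · rintro ⟨h, -⟩ h0
      exact h ((hzero i).2 h0)
    · exact fun h => ⟨fun h0 => h ((hzero i).1 h0), hr _ _ (hL i)⟩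
  · rintro i ⟨hi, hri⟩ j ⟨hj, hrj⟩ hij γ hγ
    have hγ0 : γ ≠ 0 := by rintro rfl; exact hi (by rw [hγ, zero_smul])
    have : L i = L j := by
      change Submodule.span k {x i} = Submodule.span k {x j}
      rw [hγ, Submodule.span_singleton_smul_eq (IsUnit.mk0 γ hγ0)]
    exact hij (by rw [← hri, ← hrj, hr _ _ this])

/-- Generators of a nontrivial skew Clifford algebra which are zero, or proportional to others,
can be discarded; the relations between the remaining ones are compatible. -/
theorem exists_reduction (hchar : (2 : k) ≠ 0) (hμ : IsMulAntisymm μ) (hφ : IsMuSymm b μ φ)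
    [Nontrivial (SCl b μ φ)] :
    ∃ (s : Set ι) (ψ : LinearMap.BilinForm k (Submodule.span k (Set.range fun i : s => b i))),
      IsMuSymm (subBasis b s) (μ.submatrix (fun i : s => (i : ι)) (fun j : s => (j : ι))) ψ ∧
      IsCompatible (subBasis b s)
        (μ.submatrix (fun i : s => (i : ι)) (fun j : s => (j : ι))) ψ ∧
      ∃ e : SCl (subBasis b s)
          (μ.submatrix (fun i : s => (i : ι)) (fun j : s => (j : ι))) ψ ≃ₐ[k] SCl b μ φ,
        ∀ v, e (SCl.g _ _ ψ v) = SCl.g b μ φ (v : V) := by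
  classical
  obtain ⟨s, r, α, hα, hrs, hs1, hs⟩ := exists_representatives (k := k)
    (fun i => SCl.g b μ φ (b i))
  have hs0 : ∀ i ∈ s, SCl.g b μ φ (b i) ≠ 0 := fun i hi =>
    (hrs i).1 ((hs1 i hi).1.symm ▸ hi)
  have hx := SCl.g_mul_g b μ φ
  let ψ : LinearMap.BilinForm k (Submodule.span k (Set.range fun i : s => b i)) :=
    φ.restrict _
  have hψ : ∀ i j : s, ψ (subBasis b s i) (subBasis b s j) = φ (b i) (b j) := fun i j => by
    rw [← subBasis_coe b s i, ← subBasis_coe b s j]; rfl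
  let ν : Matrix s s k := μ.submatrix (fun i : s => (i : ι)) (fun j : s => (j : ι))
  have hν : IsMulAntisymm ν := fun i j => hμ i j
  let y : s → SCl (subBasis b s) ν ψ := fun i => SCl.g _ ν ψ (subBasis b s i)
  have hy : ∀ i j : s, y i * y j + μ i j • (y j * y i)
      = algebraMap k _ (2 * φ (b i) (b j)) := fun i j => by
    rw [← hψ i j]
    exact SCl.g_mul_g (subBasis b s) ν ψ i j
  have hysq : ∀ i : s, y i * y i = φ (b i) (b i) • (1 : SCl (subBasis b s) ν ψ) :=
    sq_eq_smul_one (μ := ν) (q := fun i j => φ (b i) (b j)) hchar hν hy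
  let f : SCl (subBasis b s) ν ψ →ₐ[k] SCl b μ φ :=
    SCl.lift (subBasis b s) ν ψ (fun i => SCl.g b μ φ (b i)) fun i j => by
      rw [hψ]; exact hx i j
  have hf : ∀ i : s, f (y i) = SCl.g b μ φ (b i) := fun i => SCl.lift_g _ _ _ _ _ i
  -- The images of the original generators under the inverse map; `r i ∉ s` means that x_i is zero.
  let z : ι → SCl (subBasis b s) ν ψ := fun i => if h : r i ∈ s then α i • y ⟨r i, h⟩ else 0
  have hfz : ∀ i, f (z i) = SCl.g b μ φ (b i) := fun i => by
    by_cases h : r i ∈ s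
    · simp only [z, dif_pos h, map_smul, hf]
      exact (hα i).symm
    · simp only [z, dif_neg h, map_zero]
      exact (not_not.1 (mt (hrs i).2 h)).symm
  -- It suffices to know that these expressions are scalars: `f` maps `z i` to x_i and scalars embed
  -- in the nontrivial algebra sCl(V, μ, φ), which then determines their values.
  have hscalar : ∀ i l, ∃ c : k, z i * z l + μ i l • (z l * z i) = algebraMap k _ c := by
    intro i l
    by_cases hi : r i ∈ s
    swap
    · exact ⟨0, by simp [z, hi]⟩
    by_cases hl : r l ∈ s
    swap
    · exact ⟨0, by simp [z, hl]⟩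
    simp only [z, dif_pos hi, dif_pos hl, smul_mul_assoc, mul_smul_comm,
      Algebra.algebraMap_eq_smul_one]
    -- With equal representatives only the square of one generator occurs, which is a scalar;
    -- otherwise μ_il agrees with the entry of μ at the representatives.
    by_cases hjm : r i = r l
    · have : (⟨r l, hl⟩ : s) = ⟨r i, hi⟩ := Subtype.ext hjm.symm
      rw [this, hysq]
      refine ⟨α i * α l * (1 + μ i l) * φ (b (r i)) (b (r i)), ?_⟩
      module
    · have h1 := mu_eq_mu_of_eq_smul hchar hμ hφ (hα i) (hα l) ((hrs i).1 hi) ((hrs l).1 hl)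
        (hs _ hi _ hl hjm) (hs _ hl _ hi (Ne.symm hjm))
      have h2 := hy ⟨r i, hi⟩ ⟨r l, hl⟩
      rw [Algebra.algebraMap_eq_smul_one] at h2
      refine ⟨α i * α l * (2 * φ (b (r i)) (b (r l))), ?_⟩
      rw [h1]
      linear_combination (norm := module) (α i * α l) • h2
  have hz : ∀ i l, z i * z l + μ i l • (z l * z i) = algebraMap k _ (2 * φ (b i) (b l)) := by
    intro i l
    obtain ⟨c, hc⟩ := hscalar i l
    have h1 := congrArg f hc
    rw [map_add, map_smul, map_mul, map_mul, hfz, hfz, AlgHom.commutes, hx] at h1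
    rw [hc, (algebraMap k (SCl b μ φ)).injective h1]
  let g : SCl b μ φ →ₐ[k] SCl (subBasis b s) ν ψ := SCl.lift b μ φ z hz
  have hg : ∀ i, g (SCl.g b μ φ (b i)) = z i := fun i => SCl.lift_g _ _ _ _ _ i
  have hfg : f.comp g = AlgHom.id k _ := TQuot.algHom_ext b fun i => by
    rw [AlgHom.comp_apply]
    change f (g (SCl.g b μ φ (b i))) = SCl.g b μ φ (b i)
    rw [hg, hfz]
  have hgf : g.comp f = AlgHom.id k _ := TQuot.algHom_ext (subBasis b s) fun i => by
    rw [AlgHom.comp_apply]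
    change g (f (y i)) = y i
    have h1 : (⟨r i, (hs1 i i.2).1.symm ▸ i.2⟩ : s) = i := Subtype.ext (hs1 i i.2).1
    have h2 : r i ∈ s := (hs1 i i.2).1.symm ▸ i.2
    rw [hf, hg]
    simp only [z, dif_pos h2, (hs1 i i.2).2, one_smul, h1]
  refine ⟨s, ψ, fun i j => ?_, fun i j l h => ?_, AlgEquiv.ofAlgHom f g hfg hgf, fun v => ?_⟩
  · rw [hψ, hψ]; exact hφ i j
  · rw [hψ] at h
    exact mul_eq_one_of_ne_smul (q := fun i j => φ (b i) (b j)) hchar hμ hx hs0 hs i.2 j.2 l.2 h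
  · have : f.toLinearMap.comp (SCl.g (subBasis b s) ν ψ)
        = (SCl.g b μ φ).comp (Submodule.subtype _) :=
      (subBasis b s).ext fun i => by
        change f (y i) = SCl.g b μ φ (subBasis b s i : V)
        rw [hf, subBasis_coe]
    exact LinearMap.congr_fun this v

end Reduction

end SkewClifford

theorem proposition4 {k V : Type*} [Field k] (hchar : (2 : k) ≠ 0) [AddCommGroup V] [Module k V]
    {n : ℕ} (b : Module.Basis (Fin n) k V) (μ : Matrix (Fin n) (Fin n) k)
    (hμ : SkewClifford.IsMulAntisymm μ) :
    (∀ P : Submodule k (TensorAlgebra k V),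
      SkewClifford.IsPBWDeformation b μ P → SkewClifford.IsZ2Graded P →
        ∃ φ : LinearMap.BilinForm k V, SkewClifford.IsMuSymm b μ φ ∧
          Nontrivial (SkewClifford.SCl b μ φ) ∧
          ∃ e : SkewClifford.TQuot (P : Set (TensorAlgebra k V)) ≃ₐ[k] SkewClifford.SCl b μ φ,
            ∀ v : V, e (SkewClifford.TQuot.gen (P : Set (TensorAlgebra k V)) v)
              = SkewClifford.SCl.g b μ φ v) ∧
    (∀ φ : LinearMap.BilinForm k V, SkewClifford.IsMuSymm b μ φ →
      Nontrivial (SkewClifford.SCl b μ φ) →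
        ∃ (s : Set (Fin n))
          (P : Submodule k (TensorAlgebra k (Submodule.span k (Set.range fun i : s => b i)))),
          SkewClifford.IsPBWDeformation (SkewClifford.subBasis b s)
              (μ.submatrix (fun i : s => (i : Fin n)) (fun j : s => (j : Fin n))) P ∧
          ∃ e : SkewClifford.TQuot (P : Set (TensorAlgebra k
              (Submodule.span k (Set.range fun i : s => b i)))) ≃ₐ[k] SkewClifford.SCl b μ φ,
            ∀ v : Submodule.span k (Set.range fun i : s => b i),
              e (SkewClifford.TQuot.gen (P : Set (TensorAlgebra k
                (Submodule.span k (Set.range fun i : s => b i)))) v)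
                = SkewClifford.SCl.g b μ φ (v : V)) := by

  refine ⟨fun P hP hgr => ?_, fun φ hφ hnt => ?_⟩
  · obtain ⟨h, hinj, -⟩ := hP
    obtain ⟨φ, hφ, hspan⟩ := h.exists_eq_span_rels hchar hμ hinj hgr
    have hnt := h.nontrivial hinj
    exact ⟨φ, hφ, (SkewClifford.TQuot.spanEquiv hspan).symm.toEquiv.nontrivial,
      SkewClifford.TQuot.spanEquiv hspan, SkewClifford.TQuot.spanEquiv_gen hspan⟩
  · obtain ⟨s, ψ, hψ, hC, e, he⟩ := SkewClifford.exists_reduction hchar hμ hφ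
    refine ⟨s, Submodule.span k (SkewClifford.rels (SkewClifford.subBasis b s)
        (μ.submatrix (fun i : s => (i : Fin n)) (fun j : s => (j : Fin n))) ψ),
      SkewClifford.isPBWDeformation_of_isCompatible (fun i j => hμ i j) hψ hC,
      (SkewClifford.TQuot.spanEquiv rfl).trans e, fun v => ?_⟩
    rw [AlgEquiv.trans_apply, SkewClifford.TQuot.spanEquiv_gen]
    exact he v
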